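/- **Setting.** Consider the one-dimensional discrete-time quantum walk on $\ell^2(\mathbb Z)\otimes\mathbb C^2$ with one-step evolution $U_\Theta=S(\mathbb 1\otimes C_\Theta)$, where $$S=\sum_{x\in\mathbb Z}\big(|x+1\rangle\langle x|\otimes|0\rangle\langle 0|+|x-1\rangle\langle x|\otimes|1\rangle\langle 1|\big),\qquad C_\Theta=\begin{pmatrix} e^{i\alpha}\cos\theta & e^{i\beta}\sin\theta\\ -e^{-i\beta}\sin\theta & e^{-i\alpha}\cos\theta\end{pmatrix},$$ with real parameters $\Theta=(\theta,\alpha,\beta)$ such that $\sin\theta\neq 0$. Let $\Psi(0)$ be a unit vector that does not depend on $\Theta$, let $\Psi_\Theta(t)=U_\Theta^t\Psi(0)$ and $\varrho_\Theta(t)=|\Psi_\Theta(t)\rangle\langle\Psi_\Theta(t)|$ for $t\in\mathbb N$. For $\mu\in\{\theta,\alpha,\beta\}$ a symmetric logarithmic derivative $L_\mu$ is a bounded self-adjoint operator with $\partial_\mu\varrho_\Theta=\frac12\{L_\mu,\varrho_\Theta\}$; the quantum Fisher information matrix and the Uhlmann curvature matrix are $$F_{\mu\nu}(t)=\tfrac12\operatorname{Tr}\big(\varrho_\Theta\{L_\mu,L_\nu\}\big),\qquad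 \mathcal U_{\mu\nu}(t)=-\tfrac i2\operatorname{Tr}\big(\varrho_\Theta[L_\mu,L_\nu]\big).$$ For $k\in(-\pi,\pi]$ put $u_k=\operatorname{diag}(e^{-ik},e^{ik})\,C_\Theta$, $O_\mu=u_k^\dagger\,\partial_\mu u_k$, $\varphi_k(0)=\sum_x e^{-ikx}\langle x|\Psi(0)\rangle\in\mathbb C^2$ (an $L^2$-convergent Fourier series) and $\varrho_0=\varrho_0(k)=|\varphi_k(0)\rangle\langle\varphi_k(0)|$. For a $2\times2$ matrix $O$ let $|O)=(\operatorname{Tr}(O\sigma_i))_{i=0,x,y,z}\in\mathbb C^4$, with $\sigma_0=\mathbb 1$ and the Pauli matrices, let $(O|$ be its conjugate transpose, and let $\tilde{\mathcal A}_k$ be the $4\times 4$ matrix with $\tilde{\mathcal A}_k|O)=|u_kOu_k^\dagger)$. Finally let $$\mathcal A_k^{\mathbb 1}=N\begin{pmatrix}\frac1N&0&0&0\\0&\sin^2(k-\beta)&-\cos(k-\beta)\sin(k-\beta)&\cot\theta\sin(k-\beta)\sin(k-\alpha)\\0&-\cos(k-\beta)\sin(k-\beta)&\cos^2(k-\beta)&-\cot\theta\cos(k-\beta)\sin(k-\alpha)\\0&\cot\theta\sin(k-\beta)\sin(k-\alpha)&-\cot\theta\cos(k-\beta)\sin(k-\alpha)&\cot^2\theta\sin^2(k-\alpha)\end{pmatrix},\qquad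 N=\frac{\sin^2\theta}{1-\cos^2\theta\cos^2(k-\alpha)}.$$ **Theorem.** For every $k$, $\mathcal A_k^{\mathbb 1}$ is the orthogonal projector onto the eigenspace of $\tilde{\mathcal A}_k$ for the eigenvalue $1$. For every $t$ and $\mu$ a symmetric logarithmic derivative exists, and for every choice of them and all $\mu,\nu\in\{\theta,\alpha,\beta\}$: 1. $\displaystyle\lim_{t\to\infty}\frac{F_{\mu\nu}(t)}{t^2}=\int_{-\pi}^{\pi}\frac{dk}{2\pi}\operatorname{Tr}(\varrho_0)\,(O_\mu|\mathcal A_k^{\mathbb 1}|O_\nu)-\Big(\int_{-\pi}^{\pi}\frac{dk}{2\pi}(O_\mu|\mathcal A_k^{\mathbb 1}|\varrho_0)\Big)\Big(\int_{-\pi}^{\pi}\frac{dk}{2\pi}(\varrho_0|\mathcal A_k^{\mathbb 1}|O_\nu)\Big).$ 2. In particular, if $\operatorname{Tr}\varrho_0(k)=1$ for almost every $k$ (for example, for a walker that starts at a single site), then $$\lim_{t\to\infty}\frac{F_{\mu\nu}(t)}{t^2}=\int_{-\pi}^{\pi}\frac{dk}{2\pi}(O_\mu|\mathcal A_k^{\mathbb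 1}|O_\nu)-\Big(\int_{-\pi}^{\pi}\frac{dk}{2\pi}(O_\mu|\mathcal A_k^{\mathbb 1}|\varrho_0)\Big)\Big(\int_{-\pi}^{\pi}\frac{dk}{2\pi}(\varrho_0|\mathcal A_k^{\mathbb 1}|O_\nu)\Big).$$ 3. $\displaystyle\lim_{t\to\infty}\frac{\mathcal U_{\mu\nu}(t)}{t^2}=0.$ -/

import Mathlib

open Real Filter Topology MeasureTheory Matrix
open scoped InnerProductSpace

namespace QWalk

noncomputable section

/-! ### Lattice, coin, and the one-step evolution -/

/-- The labels of the three unknown real parameters of the coin. -/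
inductive CoinParam where
  | theta
  | alpha
  | beta
  deriving DecidableEq

/-- A value of the three parameters. -/
abbrev Params := CoinParam → ℝ

/-- The position space `ℓ²(ℤ)`. -/
abbrev Position := lp (fun _ : ℤ => ℂ) 2

/-- The lattice-coin space `ℓ²(ℤ) ⊗ ℂ²`, as two copies of `ℓ²(ℤ)`: the component `ψ j` holds the
amplitudes `c_{x,j} = ψ j x` of `|x⟩ ⊗ |j⟩`. -/
abbrev Walker := PiLp 2 (fun _ : Fin 2 => Position)

/-- The basis vector `|x⟩ ⊗ |j⟩`. -/
def ket (x : ℤ) (j : Fin 2) : Walker := PiLp.single 2 j (lp.single 2 x (1 : ℂ))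

/-- The translation `|x⟩ ↦ |x + a⟩` of `ℓ²(ℤ)`, that is `(T_a f)(x) = f (x - a)`. -/
def latticeTranslate (a : ℤ) : Position →ₗᵢ[ℂ] Position where
  toFun f := ⟨fun x => f (x - a), by
    have h := (memℓp_gen_iff (p := 2) (by norm_num)).mp (lp.memℓp f)
    exact (memℓp_gen_iff (p := 2) (by norm_num)).mpr ((Equiv.subRight a).summable_iff.mpr h)⟩
  map_add' f g := by ext x; rfl
  map_smul' c f := by ext x; rfl
  norm_map' f := by
    rw [lp.norm_eq_tsum_rpow (by norm_num), lp.norm_eq_tsum_rpow (by norm_num)]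
    congr 1
    exact (Equiv.subRight a).tsum_eq (fun x => ‖f x‖ ^ (2 : ENNReal).toReal)

/-- The coin matrix `C_{θ,α,β}`. -/
def coin (Θ : Params) : Matrix (Fin 2) (Fin 2) ℂ :=
  !![Complex.exp (Complex.I * Θ .alpha) * Real.cos (Θ .theta),
      Complex.exp (Complex.I * Θ .beta) * Real.sin (Θ .theta);
    -(Complex.exp (-(Complex.I * Θ .beta)) * Real.sin (Θ .theta)),
      Complex.exp (-(Complex.I * Θ .alpha)) * Real.cos (Θ .theta)]

/-- The operator `𝟙 ⊗ C` on the lattice-coin space. -/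
def coinOp (C : Matrix (Fin 2) (Fin 2) ℂ) : Walker →L[ℂ] Walker :=
  (PiLp.continuousLinearEquiv 2 ℂ (fun _ : Fin 2 => Position)).symm.toContinuousLinearMap ∘L
    ContinuousLinearMap.pi (fun i => ∑ j, C i j • PiLp.proj 2 (fun _ : Fin 2 => Position) j)

/-- The conditional shift `S = ∑ₓ |x+1⟩⟨x| ⊗ |0⟩⟨0| + |x-1⟩⟨x| ⊗ |1⟩⟨1|`. -/
def shiftOp : Walker →L[ℂ] Walker :=
  (PiLp.continuousLinearEquiv 2 ℂ (fun _ : Fin 2 => Position)).symm.toContinuousLinearMap ∘L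
    ContinuousLinearMap.pi (fun i =>
      (latticeTranslate (![1, -1] i)).toContinuousLinearMap ∘L
        PiLp.proj 2 (fun _ : Fin 2 => Position) i)

/-- The one-step evolution `U_Θ = S (𝟙 ⊗ C_Θ)`. -/
def evolution (Θ : Params) : Walker →L[ℂ] Walker := shiftOp ∘L coinOp (coin Θ)

/-- The state `|Ψ_Θ(t)⟩ = U_Θ^t |Ψ(0)⟩` after `t` steps. -/
def stateAt (Ψ₀ : Walker) (t : ℕ) (Θ : Params) : Walker := (evolution Θ ^ t) Ψ₀

/-- The density operator `|Ψ_Θ(t)⟩⟨Ψ_Θ(t)|` after `t` steps. -/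
def densityAt (Ψ₀ : Walker) (t : ℕ) (Θ : Params) : Walker →L[ℂ] Walker :=
  InnerProductSpace.rankOne ℂ (stateAt Ψ₀ t Θ) (stateAt Ψ₀ t Θ)

/-! ### Quantum Fisher information and Uhlmann curvature -/

/-- The trace `∑_{x,j} ⟨x,j| T |x,j⟩` (used below for finite-rank operators only). -/
def opTrace (T : Walker →L[ℂ] Walker) : ℂ :=
  ∑' p : ℤ × Fin 2, ⟪ket p.1 p.2, T (ket p.1 p.2)⟫_ℂ

/-- `L` is a symmetric logarithmic derivative, with respect to the parameter `μ` and at the point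
`Θ`, of the family `ρ` of density operators: `L` is self-adjoint, and the partial derivative
`∂_μ ρ` (in operator norm) exists at `Θ` and equals `½ {L, ρ_Θ}`. -/
def IsSLD (ρ : Params → Walker →L[ℂ] Walker) (Θ : Params) (μ : CoinParam)
    (L : Walker →L[ℂ] Walker) : Prop :=
  IsSelfAdjoint L ∧
    HasDerivAt (fun s : ℝ => ρ (Function.update Θ μ s))
      ((1 / 2 : ℂ) • (L * ρ Θ + ρ Θ * L)) (Θ μ)

/-- The quantum Fisher information `½ Tr (ρ {L₁, L₂})`. -/
def qfi (ρ L₁ L₂ : Walker →L[ℂ] Walker) : ℂ :=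
  (1 / 2 : ℂ) * opTrace (ρ * (L₁ * L₂ + L₂ * L₁))

/-- The Uhlmann curvature `-(i/2) Tr (ρ [L₁, L₂])`. -/
def uhlmann (ρ L₁ L₂ : Walker →L[ℂ] Walker) : ℂ :=
  -(Complex.I / 2) * opTrace (ρ * (L₁ * L₂ - L₂ * L₁))

/-! ### Momentum space -/

instance : Fact (0 < 2 * π) := ⟨Real.two_pi_pos⟩

/-- The initial amplitude `φ_k(0) = ⟨k|Ψ(0)⟩ = ∑ₓ e^{-ikx} (c_{x,0}, c_{x,1})`. The series
converges in `L²(dk/2π)` on the circle `ℝ/2πℤ`, and `φ` is defined for almost every `k`. -/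
def amplitude (Ψ₀ : Walker) (k : ℝ) (j : Fin 2) : ℂ :=
  ((fourierBasis (T := 2 * π)).repr.symm (Ψ₀ j) : AddCircle (2 * π) → ℂ)
    ((-k : ℝ) : AddCircle (2 * π))

/-- The coin operator `ϱ₀ = |φ_k(0)⟩⟨φ_k(0)|` of the initial state at momentum `k`. -/
def rhoZero (Ψ₀ : Walker) (k : ℝ) : Matrix (Fin 2) (Fin 2) ℂ :=
  vecMulVec (amplitude Ψ₀ k) (star (amplitude Ψ₀ k))

/-- The step `u_k = (e^{-ik} |0⟩⟨0| + e^{ik} |1⟩⟨1|) C_Θ` at momentum `k`. -/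
def stepAt (k : ℝ) (Θ : Params) : Matrix (Fin 2) (Fin 2) ℂ :=
  diagonal ![Complex.exp (-(Complex.I * k)), Complex.exp (Complex.I * k)] * coin Θ

/-- `O_μ = u_k† ∂_μ u_k`. -/
def genAt (k : ℝ) (Θ : Params) (μ : CoinParam) : Matrix (Fin 2) (Fin 2) ℂ :=
  (stepAt k Θ)ᴴ *
    Matrix.of fun i j => deriv (fun s : ℝ => stepAt k (Function.update Θ μ s) i j) (Θ μ)

/-! ### Bloch representation -/

/-- `σ₀ = 𝟙, σ_x, σ_y, σ_z`. -/
def pauli : Fin 4 → Matrix (Fin 2) (Fin 2) ℂ :=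
  ![1, !![0, 1; 1, 0], !![0, -Complex.I; Complex.I, 0], !![1, 0; 0, -1]]

/-- The vector `|O) = (Tr (O σ_i))_i` of coefficients of `O = ½ ∑ᵢ oᵢ σᵢ`. -/
def bloch (O : Matrix (Fin 2) (Fin 2) ℂ) : Fin 4 → ℂ := fun i => (O * pauli i).trace

/-- The matrix, acting on vectors `|O)`, of the superoperator `O ↦ u_k O u_k†`. -/
def superop (k : ℝ) (Θ : Params) : Matrix (Fin 4) (Fin 4) ℂ :=
  Matrix.of fun i j => bloch (stepAt k Θ * ((1 / 2 : ℂ) • pauli j) * (stepAt k Θ)ᴴ) i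

/-- `N = sin² θ / (1 - cos² θ cos² (k - α))`. -/
def normFactor (k : ℝ) (Θ : Params) : ℝ :=
  Real.sin (Θ .theta) ^ 2 /
    (1 - Real.cos (Θ .theta) ^ 2 * Real.cos (k - Θ .alpha) ^ 2)

/-- The explicit matrix `A_k^𝟙`, for real entries. -/
def projRe (k : ℝ) (Θ : Params) : Matrix (Fin 4) (Fin 4) ℝ :=
  let N := normFactor k Θ
  let ct := Real.cot (Θ .theta)
  let sb := Real.sin (k - Θ .beta)
  let cb := Real.cos (k - Θ .beta)
  let sa := Real.sin (k - Θ .alpha)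
  N • !![1 / N, 0, 0, 0;
    0, sb ^ 2, -cb * sb, ct * sb * sa;
    0, -cb * sb, cb ^ 2, -ct * cb * sa;
    0, ct * sb * sa, -ct * cb * sa, ct ^ 2 * sa ^ 2]

/-- The explicit matrix `A_k^𝟙`, acting on complex vectors. -/
def projOne (k : ℝ) (Θ : Params) : Matrix (Fin 4) (Fin 4) ℂ :=
  (projRe k Θ).map (fun r : ℝ => (r : ℂ))

/-- `(A| A_k^𝟙 |B)`, where `(A|` is the conjugate transpose of `|A)`. -/
def form (k : ℝ) (Θ : Params) (A B : Matrix (Fin 2) (Fin 2) ℂ) : ℂ :=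
  star (bloch A) ⬝ᵥ (projOne k Θ *ᵥ bloch B)

/-- `∫_{-π}^{π} f(k) dk/(2π)`. -/
def kInt (f : ℝ → ℂ) : ℂ := ∫ k in (-π)..π, f k / (2 * π)

end

end QWalk

/-!
For a pure state `ψ` with partial derivatives `χ_μ`, the defining equation of a symmetric
logarithmic derivative forces `L_μ ψ = 2 (χ_μ - ⟪ψ, χ_μ⟫ ψ)`. So, whatever the choice of `L`, `F`
and `𝒰` are, up to a constant factor, the symmetric and antisymmetric parts of the geometric
tensor `4 (⟪χ_μ, χ_ν⟫ - ⟪χ_μ, ψ⟫ ⟪ψ, χ_ν⟫)`. In momentum space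
`∂_μ (u_k^t) = u_k^t ∑_{s < t} (u_k†)ˢ O_μ u_kˢ`, and `u_k^t` drops out of the inner products. By
von Neumann's mean ergodic theorem for the unitary Bloch superoperator, the Heisenberg sums
divided by `t` converge to the observable with Bloch vector `A_k^𝟙 |O_μ)`; dominated convergence
over `k` gives the limit of the geometric tensor over `t²`. As `O_μ` is skew-Hermitian, `ϱ₀`
Hermitian and `A_k^𝟙` real symmetric, this limit is symmetric in `μ` and `ν`, and the curvature
vanishes.

The Bloch vectors fixed by conjugation with a matrix in `SU(2)` other than `±𝟙` are those whose
vector part is along the rotation axis; hence `A_k^𝟙` projects onto the span of `𝟙` and the axis.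
Since `O_μ` is traceless, its projection is a multiple of the observable along the axis, whose
square is scalar; so `ϱ₀` enters the first term only by its trace.
-/

namespace QWalk

/-! ### The mean ergodic theorem -/

section MeanErgodic

lemma tendsto_birkhoffAverage_of_isStarProjection {𝕜 E : Type*} [RCLike 𝕜]
    [NormedAddCommGroup E] [InnerProductSpace 𝕜 E] [CompleteSpace E] {f p : E →L[𝕜] E}
    (hf : ‖f‖ ≤ 1) (hp : IsStarProjection p) (hfix : ∀ x, p x = x ↔ f x = x) (x : E) :
    Tendsto (birkhoffAverage 𝕜 f id · x) atTop (𝓝 (p x)) := by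
  obtain ⟨_, hrange⟩ := isStarProjection_iff_eq_starProjection_range.mp hp
  have hmem : ∀ y, y ∈ p.range ↔ p y = y := fun y => by
    nth_rw 2 [hrange]
    exact Submodule.starProjection_eq_self_iff.symm
  have heq : p.range = f.eqLocus (1 : E →L[𝕜] E) := by
    ext y
    exact (hmem y).trans (hfix y)
  convert! f.tendsto_birkhoffAverage_orthogonalProjection hf x using 2
  rw [hrange, Submodule.starProjection_apply]
  congr! 

variable {n : Type*} [Fintype n] [DecidableEq n]

lemma conjTranspose_mulVec_eq_self_iff {U : Matrix n n ℂ} (hU : U ∈ unitaryGroup n ℂ)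
    (v : n → ℂ) : Uᴴ *ᵥ v = v ↔ U *ᵥ v = v := by
  have hU' : U * Uᴴ = 1 := mem_unitaryGroup_iff.mp hU
  have hU'' : Uᴴ * U = 1 := mem_unitaryGroup_iff'.mp hU
  constructor <;> intro h <;> nth_rw 1 [← h] <;> simp only [mulVec_mulVec, one_mulVec, hU', hU'']

lemma tendsto_inv_smul_sum_pow_mulVec {U P : Matrix n n ℂ} (hU : U ∈ unitaryGroup n ℂ)
    (hP : IsStarProjection P) (hfix : ∀ v, P *ᵥ v = v ↔ U *ᵥ v = v) (v : n → ℂ) :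
    Tendsto (fun t : ℕ => (t : ℂ)⁻¹ • ∑ s ∈ Finset.range t, (U ^ s) *ᵥ v) atTop
      (𝓝 (P *ᵥ v)) := by
  let φ := toEuclideanCLM (n := n) (𝕜 := ℂ)
  have hUφ : φ U ∈ unitary (EuclideanSpace ℂ n →L[ℂ] EuclideanSpace ℂ n) :=
    Unitary.map_mem φ hU
  have hfixφ : ∀ x, φ P x = x ↔ φ U x = x := fun x => by
    simpa only [φ, ← WithLp.ofLp_injective 2 |>.eq_iff, ofLp_toEuclideanCLM] using hfix x.ofLp
  have hnorm : ‖φ U‖ ≤ 1 := by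
    rw [← mul_one (φ U), CStarRing.norm_mem_unitary_mul 1 hUφ]
    exact ContinuousLinearMap.norm_id_le
  have hlim := tendsto_birkhoffAverage_of_isStarProjection hnorm ⟨hP.1.map φ, hP.2.map φ⟩
    hfixφ (WithLp.toLp 2 v)
  have hpow : ∀ s, (φ U)^[s] (WithLp.toLp 2 v) = WithLp.toLp 2 ((U ^ s) *ᵥ v) := fun s => by
    rw [← FunLike.coe_pow_eq_iterate, ← map_pow]
    exact toEuclideanCLM_toLp _ _
  have hlim' := ((PiLp.continuous_ofLp 2 _).tendsto _).comp hlim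
  simpa [birkhoffAverage, birkhoffSum, hpow, Function.comp_def, φ] using hlim'

end MeanErgodic

/-! ### Symmetric logarithmic derivatives of pure states -/

section PureState

open InnerProductSpace

variable {E : Type*} [NormedAddCommGroup E] [InnerProductSpace ℂ E] {ψ χ χ₁ χ₂ : E}

/-- The quantum geometric tensor `4 (⟨∂_μ ψ|∂_ν ψ⟩ - ⟨∂_μ ψ|ψ⟩⟨ψ|∂_ν ψ⟩)` of a family of unit
vectors, as a function of the vector and of its two partial derivatives. Its symmetric part is the
quantum Fisher information; its antisymmetric part is, up to a factor, the Uhlmann curvature. -/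
noncomputable def geometricTensor (ψ χ₁ χ₂ : E) : ℂ :=
  4 * (⟪χ₁, χ₂⟫_ℂ - ⟪χ₁, ψ⟫_ℂ * ⟪ψ, χ₂⟫_ℂ)

lemma inner_add_inner_eq_zero_of_norm_eq {ψ : ℝ → E} {x r : ℝ} (hψ : HasDerivAt ψ χ x)
    (hnorm : ∀ s, ‖ψ s‖ = r) : ⟪ψ x, χ⟫_ℂ + ⟪χ, ψ x⟫_ℂ = 0 := by
  have hconst : (fun s => ⟪ψ s, ψ s⟫_ℂ) = fun _ => (r : ℂ) ^ 2 := by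
    ext s
    rw [inner_self_eq_norm_sq_to_K, hnorm]
    rfl
  exact (hψ.inner ℂ hψ).unique (hconst ▸ hasDerivAt_const _ _)

lemma isBoundedBilinearMap_rankOne :
    IsBoundedBilinearMap ℝ (fun p : E × E => rankOne ℂ p.1 p.2) where
  add_left x₁ x₂ y := by rw [map_add]; rfl
  smul_left c x y := by
    ext1 z
    exact smul_comm ⟪y, z⟫_ℂ c x
  add_right x y₁ y₂ := map_add _ _ _
  smul_right c x y := by
    ext1 z
    simp only [rankOne_apply, inner_smul_left_eq_smul, _root_.smul_apply, smul_assoc]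
  bound := ⟨1, one_pos, fun x y => by simp only [one_mul, norm_rankOne, le_refl]⟩

lemma hasDerivAt_rankOne_self {ψ : ℝ → E} {x : ℝ} (hψ : HasDerivAt ψ χ x) :
    HasDerivAt (fun s => rankOne ℂ (ψ s) (ψ s)) (rankOne ℂ (ψ x) χ + rankOne ℂ χ (ψ x)) x := by
  have h := isBoundedBilinearMap_rankOne.hasFDerivAt (ψ x, ψ x)
  exact h.comp_hasDerivAt x (hψ.prodMk hψ)

lemma anticommutator_rankOne_deriv (hψ : ‖ψ‖ = 1) (hχ : ⟪ψ, χ⟫_ℂ + ⟪χ, ψ⟫_ℂ = 0) :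
    (1 / 2 : ℂ) • (((2 : ℂ) • (rankOne ℂ ψ χ + rankOne ℂ χ ψ)) * rankOne ℂ ψ ψ +
      rankOne ℂ ψ ψ * ((2 : ℂ) • (rankOne ℂ ψ χ + rankOne ℂ χ ψ))) =
      rankOne ℂ ψ χ + rankOne ℂ χ ψ := by
  have hχ' : ⟪χ, ψ⟫_ℂ = -⟪ψ, χ⟫_ℂ := eq_neg_of_add_eq_zero_right hχ
  ext1 z
  simp only [_root_.smul_apply, _root_.add_apply, mul_apply_eq_comp, rankOne_apply,
    inner_smul_right, inner_add_right, inner_self_eq_one_of_norm_eq_one hψ, hχ']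
  module

lemma apply_eq_of_anticommutator_eq {L : E →L[ℂ] E} (hψ : ‖ψ‖ = 1)
    (hχ : ⟪ψ, χ⟫_ℂ + ⟪χ, ψ⟫_ℂ = 0)
    (hL : (1 / 2 : ℂ) • (L * rankOne ℂ ψ ψ + rankOne ℂ ψ ψ * L) =
      rankOne ℂ ψ χ + rankOne ℂ χ ψ) :
    L ψ = (2 : ℂ) • (χ - ⟪ψ, χ⟫_ℂ • ψ) := by
  have hψψ := inner_self_eq_one_of_norm_eq_one (𝕜 := ℂ) hψ
  have hχ' : ⟪χ, ψ⟫_ℂ = -⟪ψ, χ⟫_ℂ := eq_neg_of_add_eq_zero_right hχ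
  have happly : (1 / 2 : ℂ) • (L ψ + ⟪ψ, L ψ⟫_ℂ • ψ) = ⟪χ, ψ⟫_ℂ • ψ + χ := by
    simpa only [_root_.smul_apply, _root_.add_apply, mul_apply_eq_comp, rankOne_apply, hψψ,
      one_smul] using congrArg (fun T : E →L[ℂ] E => T ψ) hL
  have hexpect : ⟪ψ, L ψ⟫_ℂ = 0 := by
    have hinner := congrArg (fun v => ⟪ψ, v⟫_ℂ) happly
    simp only [inner_smul_right, inner_add_right, hψψ, hχ'] at hinner
    linear_combination hinner
  rw [hexpect, zero_smul, add_zero, hχ'] at happly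
  rw [← one_smul ℂ (L ψ), show (1 : ℂ) = 2 * (1 / 2) by norm_num, mul_smul, happly]
  module

lemma inner_apply_apply_eq_geometricTensor [CompleteSpace E] {L M : E →L[ℂ] E}
    (hL : IsSelfAdjoint L) (hψ : ‖ψ‖ = 1) (hLψ : L ψ = (2 : ℂ) • (χ₁ - ⟪ψ, χ₁⟫_ℂ • ψ))
    (hMψ : M ψ = (2 : ℂ) • (χ₂ - ⟪ψ, χ₂⟫_ℂ • ψ)) :
    ⟪ψ, L (M ψ)⟫_ℂ = geometricTensor ψ χ₁ χ₂ := by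
  have hsymm : ⟪ψ, L (M ψ)⟫_ℂ = ⟪L ψ, M ψ⟫_ℂ := (hL.isSymmetric ψ (M ψ)).symm
  rw [hsymm, hLψ, hMψ, geometricTensor]
  simp only [inner_smul_left, inner_smul_right, inner_sub_left, inner_sub_right,
    inner_self_eq_one_of_norm_eq_one hψ, inner_conj_symm, map_ofNat]
  ring

end PureState

/-! ### Expectation values -/

lemma hasSum_prod_of_fintype {ι κ M : Type*} [Fintype κ] [AddCommMonoid M] [TopologicalSpace M]
    [ContinuousAdd M] {f : ι × κ → M} {a : κ → M}
    (h : ∀ j, HasSum (fun i => f (i, j)) (a j)) : HasSum f (∑ j, a j) := by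
  classical
  have hfiber : ∀ j, HasSum (fun p : ι × κ => if p.2 = j then f p else 0) (a j) := fun j => by
    refine ((Prod.mk_left_injective j).hasSum_iff ?_).mp ?_
    · rintro ⟨i, j'⟩ hp
      exact if_neg fun hj => hp ⟨i, by rw [← hj]⟩
    · simpa only [Function.comp_def, if_true] using h j
  simpa only [Finset.sum_ite_eq, Finset.mem_univ, if_true] using
    hasSum_sum (s := Finset.univ) fun j _ => hfiber j

lemma inner_ket (x : ℤ) (j : Fin 2) (Ψ : Walker) : ⟪ket x j, Ψ⟫_ℂ = Ψ j x := by
  rw [ket, PiLp.inner_apply, Finset.sum_eq_single j]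
  · simp [lp.inner_single_left]
  · intro i _ hi
    simp [hi]
  · simp

lemma hasSum_inner_mul_inner_ket (Ψ Φ : Walker) :
    HasSum (fun p : ℤ × Fin 2 => ⟪Ψ, ket p.1 p.2⟫_ℂ * ⟪ket p.1 p.2, Φ⟫_ℂ) ⟪Ψ, Φ⟫_ℂ := by
  rw [PiLp.inner_apply]
  refine hasSum_prod_of_fintype fun j => ?_
  simpa only [← inner_conj_symm Ψ, inner_ket, RCLike.inner_apply, mul_comm] using
    lp.hasSum_inner (𝕜 := ℂ) (Ψ j) (Φ j)

lemma opTrace_rankOne_self_mul (Ψ : Walker) (T : Walker →L[ℂ] Walker) :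
    opTrace (InnerProductSpace.rankOne ℂ Ψ Ψ * T) = ⟪Ψ, T Ψ⟫_ℂ := by
  rw [opTrace, ← ContinuousLinearMap.adjoint_inner_left,
    ← (hasSum_inner_mul_inner_ket _ Ψ).tsum_eq]
  refine tsum_congr fun p => ?_
  rw [mul_apply_eq_comp, InnerProductSpace.rankOne_apply, inner_smul_right,
    ContinuousLinearMap.adjoint_inner_left]

/-! ### Fisher information and Uhlmann curvature of a family of pure states -/

section PureFamily

open InnerProductSpace

variable {Ψ : Params → Walker} (hΨ : ∀ Θ, ‖Ψ Θ‖ = 1) {Θ : Params} {μ ν : CoinParam}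
  {χ χ₁ χ₂ : Walker} {L M : Walker →L[ℂ] Walker}

include hΨ

lemma inner_partialDeriv_add_eq_zero
    (hχ : HasDerivAt (fun s : ℝ => Ψ (Function.update Θ μ s)) χ (Θ μ)) :
    ⟪Ψ Θ, χ⟫_ℂ + ⟪χ, Ψ Θ⟫_ℂ = 0 := by
  simpa only [Function.update_eq_self] using
    inner_add_inner_eq_zero_of_norm_eq hχ fun s => hΨ _

omit hΨ in
lemma hasDerivAt_rankOne_update
    (hχ : HasDerivAt (fun s : ℝ => Ψ (Function.update Θ μ s)) χ (Θ μ)) :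
    HasDerivAt (fun s : ℝ => rankOne ℂ (Ψ (Function.update Θ μ s)) (Ψ (Function.update Θ μ s)))
      (rankOne ℂ (Ψ Θ) χ + rankOne ℂ χ (Ψ Θ)) (Θ μ) := by
  have h := hasDerivAt_rankOne_self hχ
  rw [Function.update_eq_self] at h
  exact h

lemma isSLD_rankOne (hχ : HasDerivAt (fun s : ℝ => Ψ (Function.update Θ μ s)) χ (Θ μ)) :
    IsSLD (fun Θ => rankOne ℂ (Ψ Θ) (Ψ Θ)) Θ μ
      ((2 : ℂ) • (rankOne ℂ (Ψ Θ) χ + rankOne ℂ χ (Ψ Θ))) := by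
  constructor
  · rw [ContinuousLinearMap.isSelfAdjoint_iff', map_smulₛₗ, map_add, adjoint_rankOne,
      adjoint_rankOne, add_comm, map_ofNat]
  · rw [anticommutator_rankOne_deriv (hΨ Θ) (inner_partialDeriv_add_eq_zero hΨ hχ)]
    exact hasDerivAt_rankOne_update hχ

lemma IsSLD.apply_eq (hL : IsSLD (fun Θ => rankOne ℂ (Ψ Θ) (Ψ Θ)) Θ μ L)
    (hχ : HasDerivAt (fun s : ℝ => Ψ (Function.update Θ μ s)) χ (Θ μ)) :
    L (Ψ Θ) = (2 : ℂ) • (χ - ⟪Ψ Θ, χ⟫_ℂ • Ψ Θ) :=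
  apply_eq_of_anticommutator_eq (hΨ Θ) (inner_partialDeriv_add_eq_zero hΨ hχ)
    (hL.2.unique (hasDerivAt_rankOne_update hχ))

variable (hL : IsSLD (fun Θ => rankOne ℂ (Ψ Θ) (Ψ Θ)) Θ μ L)
  (hM : IsSLD (fun Θ => rankOne ℂ (Ψ Θ) (Ψ Θ)) Θ ν M)
  (hχ₁ : HasDerivAt (fun s : ℝ => Ψ (Function.update Θ μ s)) χ₁ (Θ μ))
  (hχ₂ : HasDerivAt (fun s : ℝ => Ψ (Function.update Θ ν s)) χ₂ (Θ ν))

include hL hM hχ₁ hχ₂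

lemma inner_mul_apply_eq_geometricTensor :
    ⟪Ψ Θ, (L * M) (Ψ Θ)⟫_ℂ = geometricTensor (Ψ Θ) χ₁ χ₂ :=
  inner_apply_apply_eq_geometricTensor hL.1 (hΨ Θ) (hL.apply_eq hΨ hχ₁) (hM.apply_eq hΨ hχ₂)

lemma qfi_eq_geometricTensor :
    qfi (rankOne ℂ (Ψ Θ) (Ψ Θ)) L M =
      1 / 2 * (geometricTensor (Ψ Θ) χ₁ χ₂ + geometricTensor (Ψ Θ) χ₂ χ₁) := by
  rw [qfi, opTrace_rankOne_self_mul, _root_.add_apply, inner_add_right,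
    inner_mul_apply_eq_geometricTensor hΨ hL hM hχ₁ hχ₂,
    inner_mul_apply_eq_geometricTensor hΨ hM hL hχ₂ hχ₁]

lemma uhlmann_eq_geometricTensor :
    uhlmann (rankOne ℂ (Ψ Θ) (Ψ Θ)) L M =
      -(Complex.I / 2) * (geometricTensor (Ψ Θ) χ₁ χ₂ - geometricTensor (Ψ Θ) χ₂ χ₁) := by
  rw [uhlmann, opTrace_rankOne_self_mul, _root_.sub_apply, inner_sub_right,
    inner_mul_apply_eq_geometricTensor hΨ hL hM hχ₁ hχ₂,
    inner_mul_apply_eq_geometricTensor hΨ hM hL hχ₂ hχ₁]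

end PureFamily

/-! ### Bloch vectors -/

section Bloch

lemma pauli_isHermitian (i : Fin 4) : (pauli i).IsHermitian := by
  ext a b
  fin_cases i <;> fin_cases a <;> fin_cases b <;> simp [pauli, conjTranspose_apply]

lemma trace_pauli_mul_pauli (i j : Fin 4) :
    (pauli i * pauli j).trace = if i = j then 2 else 0 := by
  fin_cases i <;> fin_cases j <;> norm_num [pauli, trace_fin_two]

/-- The matrix `½ ∑ᵢ vᵢ σᵢ` with Bloch coefficients `v`, so that `ofBloch` inverts `bloch`. -/
noncomputable def ofBloch (v : Fin 4 → ℂ) : Matrix (Fin 2) (Fin 2) ℂ :=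
  ∑ j, v j • ((1 / 2 : ℂ) • pauli j)

lemma bloch_ofBloch (v : Fin 4 → ℂ) : bloch (ofBloch v) = v := by
  ext i
  simp only [bloch, ofBloch, Finset.sum_mul, trace_sum, Matrix.smul_mul, trace_smul,
    trace_pauli_mul_pauli, smul_eq_mul, mul_ite, mul_zero, Finset.sum_ite_eq', Finset.mem_univ,
    if_true]
  ring

lemma ofBloch_bloch (O : Matrix (Fin 2) (Fin 2) ℂ) : ofBloch (bloch O) = O := by
  ext a b
  fin_cases a <;> fin_cases b <;>
    simp [ofBloch, bloch, pauli, Fin.sum_univ_four, trace_fin_two, Matrix.add_apply,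
      Matrix.mul_apply] <;>
    ring_nf <;> simp <;> ring

lemma bloch_injective : Function.Injective bloch :=
  Function.LeftInverse.injective ofBloch_bloch

lemma bloch_neg (O : Matrix (Fin 2) (Fin 2) ℂ) : bloch (-O) = -bloch O := by
  ext i
  simp only [bloch, Matrix.neg_mul, trace_neg, Pi.neg_apply]

lemma bloch_conjTranspose (O : Matrix (Fin 2) (Fin 2) ℂ) : bloch Oᴴ = star (bloch O) := by
  ext i
  rw [Pi.star_apply, bloch, bloch, ← trace_conjTranspose, conjTranspose_mul,
    (pauli_isHermitian i).eq, trace_mul_comm]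

lemma trace_mul_ofBloch (A : Matrix (Fin 2) (Fin 2) ℂ) (v : Fin 4 → ℂ) :
    (A * ofBloch v).trace = 1 / 2 * (bloch A ⬝ᵥ v) := by
  simp only [ofBloch, bloch, dotProduct, Finset.mul_sum, trace_sum, Matrix.mul_smul, trace_smul,
    smul_eq_mul]
  exact Finset.sum_congr rfl fun j _ => by ring

/-- The matrix of the superoperator `O ↦ V O V†` in Bloch coordinates. -/
noncomputable def blochConj (V : Matrix (Fin 2) (Fin 2) ℂ) : Matrix (Fin 4) (Fin 4) ℂ :=
  Matrix.of fun i j => bloch (V * ((1 / 2 : ℂ) • pauli j) * Vᴴ) i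

variable (V W O : Matrix (Fin 2) (Fin 2) ℂ)

lemma blochConj_mulVec (v : Fin 4 → ℂ) : blochConj V *ᵥ v = bloch (V * ofBloch v * Vᴴ) := by
  ext i
  simp only [mulVec, dotProduct, blochConj, of_apply, bloch, ofBloch, Finset.mul_sum,
    Finset.sum_mul, trace_sum, Matrix.mul_smul, Matrix.smul_mul, trace_smul, smul_eq_mul]
  exact Finset.sum_congr rfl fun j _ => by ring

lemma blochConj_mulVec_bloch : blochConj V *ᵥ bloch O = bloch (V * O * Vᴴ) := by
  rw [blochConj_mulVec, ofBloch_bloch]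

lemma blochConj_one : blochConj 1 = 1 := by
  refine ext_iff_mulVec.mpr fun v => ?_
  rw [blochConj_mulVec, conjTranspose_one, Matrix.one_mul, Matrix.mul_one, bloch_ofBloch,
    one_mulVec]

lemma blochConj_mul : blochConj (V * W) = blochConj V * blochConj W := by
  refine ext_iff_mulVec.mpr fun v => ?_
  rw [← mulVec_mulVec, blochConj_mulVec W, blochConj_mulVec_bloch, blochConj_mulVec,
    conjTranspose_mul]
  simp only [Matrix.mul_assoc]

lemma blochConj_pow (s : ℕ) : blochConj (V ^ s) = blochConj V ^ s := by
  induction s with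
  | zero => rw [pow_zero, pow_zero, blochConj_one]
  | succ s ih => rw [pow_succ, pow_succ, blochConj_mul, ih]

lemma blochConj_conjTranspose : blochConj Vᴴ = (blochConj V)ᴴ := by
  ext i j
  simp only [conjTranspose_apply, blochConj, of_apply, bloch, Matrix.mul_smul, Matrix.smul_mul,
    trace_smul, smul_eq_mul, star_mul', conjTranspose_conjTranspose, ← trace_conjTranspose,
    conjTranspose_mul, (pauli_isHermitian _).eq]
  rw [star_div₀, star_one, star_ofNat, Matrix.mul_assoc, Matrix.mul_assoc, trace_mul_comm Vᴴ]
  simp only [Matrix.mul_assoc]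

variable {V}

lemma blochConj_mem_unitaryGroup (hV : V ∈ unitaryGroup (Fin 2) ℂ) :
    blochConj V ∈ unitaryGroup (Fin 4) ℂ := by
  rw [mem_unitaryGroup_iff, star_eq_conjTranspose, ← blochConj_conjTranspose, ← blochConj_mul,
    ← star_eq_conjTranspose, mem_unitaryGroup_iff.mp hV, blochConj_one]

lemma blochConj_mulVec_eq_self_iff (hV : V ∈ unitaryGroup (Fin 2) ℂ) (v : Fin 4 → ℂ) :
    blochConj V *ᵥ v = v ↔ Commute V (ofBloch v) := by
  have hV' : V * Vᴴ = 1 := mem_unitaryGroup_iff.mp hV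
  have hV'' : Vᴴ * V = 1 := mem_unitaryGroup_iff'.mp hV
  rw [blochConj_mulVec]
  nth_rw 2 [← bloch_ofBloch v]
  rw [bloch_injective.eq_iff, commute_iff_eq]
  constructor <;> intro h
  · nth_rw 2 [← h]
    rw [Matrix.mul_assoc _ Vᴴ, hV'', Matrix.mul_one]
  · rw [h, Matrix.mul_assoc, hV', Matrix.mul_one]

end Bloch

/-! ### Spin matrices -/

section Spin

/-- The spin matrix `q · σ` of a complex vector `q`. -/
noncomputable def spin (q : Fin 3 → ℂ) : Matrix (Fin 2) (Fin 2) ℂ := ∑ i, q i • pauli i.succ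

lemma spin_eq (q : Fin 3 → ℂ) :
    spin q = !![q 2, q 0 - Complex.I * q 1; q 0 + Complex.I * q 1, -q 2] := by
  ext a b
  fin_cases a <;> fin_cases b <;>
    simp [spin, pauli, Fin.sum_univ_three, Matrix.add_apply] <;> ring

lemma spin_smul (c : ℂ) (q : Fin 3 → ℂ) : spin (c • q) = c • spin q := by
  simp only [spin, Finset.smul_sum, Pi.smul_apply, smul_assoc]

lemma spin_conjTranspose (q : Fin 3 → ℂ) : (spin q)ᴴ = spin (star q) := by
  simp only [spin, conjTranspose_sum, conjTranspose_smul, (pauli_isHermitian _).eq, Pi.star_apply]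

lemma ofBloch_eq_spin (v : Fin 4 → ℂ) :
    ofBloch v = (1 / 2 : ℂ) • (v 0 • 1 + spin (Fin.tail v)) := by
  simp only [ofBloch, spin, Fin.sum_univ_succ (n := 3), smul_add, Finset.smul_sum, Fin.tail,
    smul_comm (1 / 2 : ℂ)]
  rfl

lemma spin_mul_spin (a b : Fin 3 → ℂ) :
    spin a * spin b = (a ⬝ᵥ b) • 1 + Complex.I • spin (a ⨯₃ b) := by
  have hI := Complex.I_sq
  rw [spin_eq, spin_eq, spin_eq, cross_apply]
  ext i j
  fin_cases i <;> fin_cases j <;>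
    simp [dotProduct, Fin.sum_univ_three] <;> ring_nf <;> simp only [hI] <;> ring

lemma spin_eq_zero_iff (q : Fin 3 → ℂ) : spin q = 0 ↔ q = 0 := by
  refine ⟨fun h => dotProduct_eq_zero q fun b => ?_, fun h => by simp [h, spin]⟩
  have htrace := congrArg trace (spin_mul_spin q b)
  simpa [h, spin_eq, trace_fin_two] using htrace

lemma commute_spin_iff (a b : Fin 3 → ℂ) : Commute (spin a) (spin b) ↔ a ⨯₃ b = 0 := by
  have hsub : spin a * spin b - spin b * spin a = (2 * Complex.I) • spin (a ⨯₃ b) := by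
    rw [spin_mul_spin, spin_mul_spin, dotProduct_comm b, ← cross_anticomm a b,
      ← neg_one_smul ℂ (a ⨯₃ b), spin_smul]
    module
  rw [commute_iff_eq, ← sub_eq_zero, hsub, smul_eq_zero_iff_right (by simp), spin_eq_zero_iff]

end Spin

/-! ### The step at fixed momentum and its rotation axis -/

section Step

/-- The shift `diag(e^{-ik}, e^{ik})` at momentum `k`. -/
noncomputable def shiftAt (k : ℝ) : Matrix (Fin 2) (Fin 2) ℂ :=
  diagonal ![Complex.exp (-(Complex.I * k)), Complex.exp (Complex.I * k)]

lemma exp_neg_mul_I_mul_exp_mul_I (a b : ℝ) :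
    Complex.exp (-(Complex.I * a)) * Complex.exp (Complex.I * b) =
      Real.cos (a - b) - Complex.I * Real.sin (a - b) := by
  rw [← Complex.exp_add, show -(Complex.I * a) + Complex.I * b = ((b - a : ℝ) : ℂ) * Complex.I by
    push_cast; ring, Complex.exp_mul_I, ← Complex.ofReal_cos, ← Complex.ofReal_sin,
    ← neg_sub a b, Real.cos_neg, Real.sin_neg]
  push_cast
  ring

lemma exp_mul_I_mul_exp_neg_mul_I (a b : ℝ) :
    Complex.exp (Complex.I * a) * Complex.exp (-(Complex.I * b)) =
      Real.cos (a - b) + Complex.I * Real.sin (a - b) := by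
  rw [mul_comm, exp_neg_mul_I_mul_exp_mul_I, ← neg_sub a b, Real.cos_neg, Real.sin_neg]
  push_cast
  ring

variable (k : ℝ) (Θ : Params)

lemma shiftAt_mem_unitaryGroup : shiftAt k ∈ unitaryGroup (Fin 2) ℂ := by
  rw [mem_unitaryGroup_iff, star_eq_conjTranspose, shiftAt, diagonal_conjTranspose,
    diagonal_mul_diagonal, ← diagonal_one]
  congr 1
  ext i
  fin_cases i <;> simp [← Complex.exp_conj, ← Complex.exp_add]

lemma det_coin : (coin Θ).det = 1 := by
  have hα := exp_mul_I_mul_exp_neg_mul_I (Θ .alpha) (Θ .alpha)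
  have hβ := exp_mul_I_mul_exp_neg_mul_I (Θ .beta) (Θ .beta)
  have htrig : ((Real.sin (Θ .theta) : ℝ) : ℂ) ^ 2 + ((Real.cos (Θ .theta) : ℝ) : ℂ) ^ 2 = 1 := by
    exact_mod_cast Real.sin_sq_add_cos_sq (Θ .theta)
  simp only [sub_self, Real.cos_zero, Real.sin_zero, Complex.ofReal_one, Complex.ofReal_zero,
    mul_zero, add_zero] at hα hβ
  simp only [coin, det_fin_two_of]
  linear_combination ((Real.cos (Θ .theta) : ℝ) : ℂ) ^ 2 * hα +
    ((Real.sin (Θ .theta) : ℝ) : ℂ) ^ 2 * hβ + htrig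

lemma adjugate_coin : (coin Θ).adjugate = (coin Θ)ᴴ := by
  ext i j
  fin_cases i <;> fin_cases j <;>
    simp [coin, adjugate_fin_two, ← Complex.exp_conj, -Complex.ofReal_cos, -Complex.ofReal_sin]

lemma coin_mem_unitaryGroup : coin Θ ∈ unitaryGroup (Fin 2) ℂ := by
  rw [mem_unitaryGroup_iff, star_eq_conjTranspose, ← adjugate_coin, mul_adjugate, det_coin,
    one_smul]

lemma stepAt_mem_unitaryGroup : stepAt k Θ ∈ unitaryGroup (Fin 2) ℂ :=
  mul_mem (shiftAt_mem_unitaryGroup k) (coin_mem_unitaryGroup Θ)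

/-- The rotation axis `q` of the step: `u_k = cos θ cos(k - α) 𝟙 - i q · σ`. -/
noncomputable def axis : Fin 3 → ℂ := fun i => ((
  ![Real.sin (Θ .theta) * Real.sin (k - Θ .beta), -(Real.sin (Θ .theta) * Real.cos (k - Θ .beta)),
    Real.cos (Θ .theta) * Real.sin (k - Θ .alpha)] i : ℝ) : ℂ)

/-- The squared length of the rotation axis. -/
noncomputable def axisSq : ℝ :=
  Real.sin (Θ .theta) ^ 2 + (Real.cos (Θ .theta) * Real.sin (k - Θ .alpha)) ^ 2

lemma stepAt_eq_spin :
    stepAt k Θ = ((Real.cos (Θ .theta) * Real.cos (k - Θ .alpha) : ℝ) : ℂ) • 1 -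
      Complex.I • spin (axis k Θ) := by
  rw [spin_eq]
  ext i j
  fin_cases i <;> fin_cases j <;>
    simp [stepAt, coin, diagonal_mul, axis, ← mul_assoc, -Complex.ofReal_sin, -Complex.ofReal_cos,
      exp_neg_mul_I_mul_exp_mul_I,
      exp_mul_I_mul_exp_neg_mul_I] <;>
    ring_nf <;> simp only [Complex.I_sq] <;> ring

lemma star_axis : star (axis k Θ) = axis k Θ := by
  ext i
  exact Complex.conj_ofReal _

lemma axis_dotProduct_self : axis k Θ ⬝ᵥ axis k Θ = axisSq k Θ := by
  simp only [axis, axisSq, dotProduct, Fin.sum_univ_three, cons_val]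
  norm_cast
  linear_combination (Real.sin (Θ .theta)) ^ 2 * Real.sin_sq_add_cos_sq (k - Θ .beta)

variable {Θ}

lemma axisSq_pos (hθ : Real.sin (Θ .theta) ≠ 0) : 0 < axisSq k Θ := by
  rw [axisSq]
  positivity

lemma axis_dotProduct_self_ne_zero (hθ : Real.sin (Θ .theta) ≠ 0) :
    axis k Θ ⬝ᵥ axis k Θ ≠ 0 := by
  rw [axis_dotProduct_self]
  exact_mod_cast (axisSq_pos k hθ).ne'

variable (Θ) in
lemma commute_stepAt_ofBloch_iff (v : Fin 4 → ℂ) :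
    Commute (stepAt k Θ) (ofBloch v) ↔ axis k Θ ⨯₃ Fin.tail v = 0 := by
  have hbracket : stepAt k Θ * ofBloch v - ofBloch v * stepAt k Θ =
      (-(Complex.I / 2)) • (spin (axis k Θ) * spin (Fin.tail v) -
        spin (Fin.tail v) * spin (axis k Θ)) := by
    rw [stepAt_eq_spin, ofBloch_eq_spin]
    simp only [Matrix.sub_mul, Matrix.mul_sub, Matrix.mul_add, Matrix.add_mul, Matrix.smul_mul,
      Matrix.mul_smul, Matrix.one_mul, Matrix.mul_one, smul_add, smul_sub]
    module
  rw [← commute_spin_iff, commute_iff_eq, commute_iff_eq, ← sub_eq_zero, hbracket,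
    smul_eq_zero_iff_right (by simp), sub_eq_zero]

lemma cross_eq_zero_iff_smul_eq {K : Type*} [Field K] {q : Fin 3 → K} (hq : q ⬝ᵥ q ≠ 0)
    (w : Fin 3 → K) : q ⨯₃ w = 0 ↔ ((q ⬝ᵥ w) / (q ⬝ᵥ q)) • q = w := by
  constructor <;> intro h
  · have htriple := cross_cross_eq_smul_sub_smul' q q w
    rw [h, map_zero, eq_comm, sub_eq_zero] at htriple
    rwa [div_eq_inv_mul, mul_smul, inv_smul_eq_iff₀ hq]
  · rw [← h, map_smul, cross_self, smul_zero]

/-! ### The projector -/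

lemma normFactor_eq : normFactor k Θ = Real.sin (Θ .theta) ^ 2 / axisSq k Θ := by
  rw [normFactor, axisSq]
  congr 1
  linear_combination (-Real.cos (Θ .theta) ^ 2) * Real.sin_sq_add_cos_sq (k - Θ .alpha) -
    Real.sin_sq_add_cos_sq (Θ .theta)

lemma projOne_zero (hθ : Real.sin (Θ .theta) ≠ 0) : projOne k Θ 0 = Fin.cons 1 0 := by
  have hN : normFactor k Θ ≠ 0 := by
    rw [normFactor_eq]
    exact div_ne_zero (pow_ne_zero 2 hθ) (axisSq_pos k hθ).ne'
  ext j
  refine Fin.cases ?_ (fun j => ?_) j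
  · simp [projOne, projRe, hN]
  · rw [Fin.cons_succ]
    fin_cases j <;> simp [projOne, projRe]

lemma projOne_succ (hθ : Real.sin (Θ .theta) ≠ 0) (i : Fin 3) :
    projOne k Θ i.succ =
      Fin.cons 0 ((axis k Θ i / (axis k Θ ⬝ᵥ axis k Θ)) • axis k Θ) := by
  have hq : (axisSq k Θ : ℂ) ≠ 0 := by exact_mod_cast (axisSq_pos k hθ).ne'
  have hsin : ((Real.sin (Θ .theta) : ℝ) : ℂ) ≠ 0 := by exact_mod_cast hθ
  rw [axis_dotProduct_self]
  ext j
  refine Fin.cases ?_ (fun j => ?_) j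
  · fin_cases i <;> simp [projOne, projRe]
  · rw [Fin.cons_succ]
    fin_cases i <;> fin_cases j <;>
      simp [projOne, projRe, normFactor_eq, axis, Real.cot_eq_cos_div_sin,
        -Complex.ofReal_sin, -Complex.ofReal_cos] <;> field_simp

lemma projOne_mulVec (hθ : Real.sin (Θ .theta) ≠ 0) (v : Fin 4 → ℂ) :
    projOne k Θ *ᵥ v = Fin.cons (v 0)
      ((axis k Θ ⬝ᵥ Fin.tail v / (axis k Θ ⬝ᵥ axis k Θ)) • axis k Θ) := by
  ext i
  refine Fin.cases ?_ (fun i => ?_) i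
  · simp [mulVec, projOne_zero k hθ, dotProduct, Fin.sum_univ_succ (n := 3)]
  · simp only [mulVec, projOne_succ k hθ, dotProduct, Fin.sum_univ_succ (n := 3), Fin.cons_zero,
      Fin.cons_succ, zero_mul, zero_add, Pi.smul_apply, smul_eq_mul, Fin.tail, Finset.sum_div,
      Finset.sum_mul]
    exact Finset.sum_congr rfl fun j _ => by ring

lemma projRe_isSymm : (projRe k Θ).IsSymm := by
  ext i j
  fin_cases i <;> fin_cases j <;> simp [projRe]

lemma projOne_isSymm : (projOne k Θ).IsSymm :=
  (projRe_isSymm k).map _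

lemma projOne_isHermitian : (projOne k Θ).IsHermitian := by
  ext i j
  rw [conjTranspose_apply, (projOne_isSymm k).apply]
  exact Complex.conj_ofReal _

lemma isStarProjection_projOne (hθ : Real.sin (Θ .theta) ≠ 0) :
    IsStarProjection (projOne k Θ) := by
  refine ⟨ext_iff_mulVec.mpr fun v => ?_, projOne_isHermitian k⟩
  rw [← mulVec_mulVec, projOne_mulVec k hθ (projOne k Θ *ᵥ v), projOne_mulVec k hθ v, Fin.tail_cons,
    Fin.cons_zero, dotProduct_smul, smul_eq_mul,
    mul_div_cancel_right₀ _ (axis_dotProduct_self_ne_zero k hθ)]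

lemma projOne_mulVec_eq_self_iff_cross (hθ : Real.sin (Θ .theta) ≠ 0) (v : Fin 4 → ℂ) :
    projOne k Θ *ᵥ v = v ↔ axis k Θ ⨯₃ Fin.tail v = 0 := by
  rw [projOne_mulVec k hθ, cross_eq_zero_iff_smul_eq (axis_dotProduct_self_ne_zero k hθ)]
  nth_rw 3 [← Fin.cons_self_tail v]
  rw [Fin.cons_right_injective _ |>.eq_iff]

lemma projOne_mulVec_eq_self_iff_superop (hθ : Real.sin (Θ .theta) ≠ 0) (v : Fin 4 → ℂ) :
    projOne k Θ *ᵥ v = v ↔ superop k Θ *ᵥ v = v := by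
  rw [projOne_mulVec_eq_self_iff_cross k hθ, ← commute_stepAt_ofBloch_iff]
  exact (blochConj_mulVec_eq_self_iff (stepAt_mem_unitaryGroup k Θ) v).symm

end Step

/-! ### Orbit averages in the Heisenberg picture -/

section OrbitAverage

open scoped Matrix.Norms.L2Operator

variable {n : Type*} [Fintype n] [DecidableEq n]

/-- The time average `t⁻¹ ∑_{s < t} (u†)ˢ O uˢ` of an observable in the Heisenberg picture. -/
noncomputable def orbitAverage (u O : Matrix n n ℂ) (t : ℕ) : Matrix n n ℂ :=
  (t : ℂ)⁻¹ • ∑ s ∈ Finset.range t, uᴴ ^ s * O * u ^ s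

lemma orbitAverage_eq_ofBloch (u O : Matrix (Fin 2) (Fin 2) ℂ) (t : ℕ) :
    orbitAverage u O t =
      ofBloch ((t : ℂ)⁻¹ • ∑ s ∈ Finset.range t, (blochConj u)ᴴ ^ s *ᵥ bloch O) := by
  have hterm : ∀ s, (blochConj u)ᴴ ^ s *ᵥ bloch O = bloch (uᴴ ^ s * O * u ^ s) := fun s => by
    rw [← blochConj_conjTranspose, ← blochConj_pow, blochConj_mulVec_bloch, conjTranspose_pow,
      conjTranspose_conjTranspose]
  simp only [hterm]
  rw [← bloch_injective.eq_iff, bloch_ofBloch]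
  ext i
  simp only [orbitAverage, bloch, Matrix.smul_mul, Finset.sum_mul, trace_smul, trace_sum,
    Pi.smul_apply, Finset.sum_apply]

lemma norm_pow_conjTranspose_mul_mul_pow {u : Matrix n n ℂ} (hu : u ∈ unitaryGroup n ℂ)
    (O : Matrix n n ℂ) (s : ℕ) :
    ‖uᴴ ^ s * O * u ^ s‖ = ‖O‖ := by
  rw [CStarRing.norm_mul_mem_unitary _ (pow_mem hu s), ← star_eq_conjTranspose,
    CStarRing.norm_mem_unitary_mul _ (pow_mem (Unitary.star_mem hu) s)]

lemma norm_orbitAverage_le {u : Matrix n n ℂ} (hu : u ∈ unitaryGroup n ℂ)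
    (O : Matrix n n ℂ) (t : ℕ) : ‖orbitAverage u O t‖ ≤ ‖O‖ := by
  rw [orbitAverage, norm_smul, norm_inv, Complex.norm_natCast]
  refine inv_mul_le_of_le_mul₀ t.cast_nonneg (norm_nonneg O) ?_
  refine (norm_sum_le _ _).trans_eq ?_
  simp only [norm_pow_conjTranspose_mul_mul_pow hu, Finset.sum_const, Finset.card_range,
    nsmul_eq_mul]

lemma pow_mul_orbitAverage {u : Matrix n n ℂ} (hu : u ∈ unitaryGroup n ℂ)
    (O : Matrix n n ℂ) (t : ℕ) :
    u ^ t * orbitAverage u O t =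
      (t : ℂ)⁻¹ • ∑ s ∈ Finset.range t, u ^ (t.pred - s) * (u * O) * u ^ s := by
  rw [orbitAverage, Matrix.mul_smul, Finset.mul_sum]
  congr 1
  refine Finset.sum_congr rfl fun s hs => ?_
  have hst := Finset.mem_range.mp hs
  have hcancel : u ^ s * uᴴ ^ s = 1 := by
    rw [← conjTranspose_pow]
    exact mem_unitaryGroup_iff.mp (pow_mem hu s)
  have hpow : u ^ t = u ^ (t.pred - s) * u * u ^ s := by
    rw [← pow_succ, ← pow_add]
    congr 1
    rw [Nat.pred_eq_sub_one]
    lia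
  calc u ^ t * (uᴴ ^ s * O * u ^ s)
      = u ^ (t.pred - s) * u * (u ^ s * uᴴ ^ s) * O * u ^ s := by
        simp only [hpow, Matrix.mul_assoc]
    _ = u ^ (t.pred - s) * (u * O) * u ^ s := by
        rw [hcancel, Matrix.mul_one, Matrix.mul_assoc (u ^ _)]

end OrbitAverage

section FixedPart

variable (k : ℝ) (Θ : Params) (A B : Matrix (Fin 2) (Fin 2) ℂ)

/-- The observable whose Bloch vector is `A_k^𝟙 |O)`: the component of `O` commuting with `u_k`. -/
noncomputable def fixedPart (O : Matrix (Fin 2) (Fin 2) ℂ) : Matrix (Fin 2) (Fin 2) ℂ :=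
  ofBloch (projOne k Θ *ᵥ bloch O)

lemma continuous_ofBloch : Continuous ofBloch := by
  unfold ofBloch
  fun_prop

variable {Θ} in
lemma tendsto_orbitAverage_stepAt (hθ : Real.sin (Θ .theta) ≠ 0)
    (O : Matrix (Fin 2) (Fin 2) ℂ) :
    Tendsto (orbitAverage (stepAt k Θ) O) atTop (𝓝 (fixedPart k Θ O)) := by
  have hu := blochConj_mem_unitaryGroup (stepAt_mem_unitaryGroup k Θ)
  refine Tendsto.congr (fun t => (orbitAverage_eq_ofBloch _ O t).symm)
    ((continuous_ofBloch.tendsto _).comp ?_)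
  refine tendsto_inv_smul_sum_pow_mulVec (Unitary.star_mem hu) (isStarProjection_projOne k hθ)
    (fun v => ?_) _
  rw [star_eq_conjTranspose, conjTranspose_mulVec_eq_self_iff hu]
  exact projOne_mulVec_eq_self_iff_superop k hθ v

lemma star_form : star (form k Θ A B) = form k Θ B A := by
  rw [form, form, ← star_dotProduct, star_mulVec, (projOne_isHermitian k).eq, dotProduct_mulVec]

lemma form_conjTranspose : form k Θ Aᴴ Bᴴ = form k Θ B A := by
  rw [form, form, bloch_conjTranspose, bloch_conjTranspose, star_star, dotProduct_mulVec,
    dotProduct_comm, ← mulVec_transpose, (projOne_isSymm k).eq]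

lemma trace_conjTranspose_mul_fixedPart :
    (Aᴴ * fixedPart k Θ B).trace = 1 / 2 * form k Θ A B := by
  rw [fixedPart, trace_mul_ofBloch, bloch_conjTranspose, form]

lemma trace_fixedPart_conjTranspose_mul :
    ((fixedPart k Θ A)ᴴ * B).trace = 1 / 2 * form k Θ A B := by
  rw [← conjTranspose_conjTranspose ((fixedPart k Θ A)ᴴ * B), conjTranspose_mul,
    conjTranspose_conjTranspose, trace_conjTranspose,
    trace_conjTranspose_mul_fixedPart, star_mul', star_form, star_div₀, star_one, star_ofNat]

variable {Θ A B}

lemma fixedPart_eq_smul_spin (hθ : Real.sin (Θ .theta) ≠ 0) (hA : A.trace = 0) :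
    fixedPart k Θ A =
      (1 / 2 * (axis k Θ ⬝ᵥ Fin.tail (bloch A) / (axis k Θ ⬝ᵥ axis k Θ))) • spin (axis k Θ) := by
  have hbloch : bloch A 0 = 0 := by rw [← hA, bloch]; exact congrArg trace (Matrix.mul_one A)
  rw [fixedPart, projOne_mulVec k hθ, ofBloch_eq_spin, Fin.cons_zero, Fin.tail_cons, hbloch,
    zero_smul, zero_add, spin_smul, smul_smul]

lemma spin_axis_mul_self : spin (axis k Θ) * spin (axis k Θ) = (axis k Θ ⬝ᵥ axis k Θ) • 1 := by
  rw [spin_mul_spin, cross_self, (spin_eq_zero_iff 0).mpr rfl, smul_zero, add_zero]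

lemma form_fixedPart (hθ : Real.sin (Θ .theta) ≠ 0) :
    form k Θ A (fixedPart k Θ B) = form k Θ A B := by
  rw [form, fixedPart, bloch_ofBloch, mulVec_mulVec, (isStarProjection_projOne k hθ).1.eq, form]

lemma fixedPart_conjTranspose_mul_fixedPart (hθ : Real.sin (Θ .theta) ≠ 0) (hA : A.trace = 0)
    (hB : B.trace = 0) :
    (fixedPart k Θ A)ᴴ * fixedPart k Θ B = (1 / 4 * form k Θ A B) • 1 := by
  obtain ⟨c, hc⟩ : ∃ c : ℂ, (fixedPart k Θ A)ᴴ * fixedPart k Θ B = c • 1 := by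
    rw [fixedPart_eq_smul_spin k hθ hA, fixedPart_eq_smul_spin k hθ hB, conjTranspose_smul,
      spin_conjTranspose, star_axis, smul_mul_smul_comm, spin_axis_mul_self, smul_smul]
    exact ⟨_, rfl⟩
  have htrace : 2 * c = 1 / 2 * form k Θ A B := by
    rw [← form_fixedPart k hθ, ← trace_fixedPart_conjTranspose_mul, hc, trace_smul, trace_one,
      Fintype.card_fin, smul_eq_mul, mul_comm, Nat.cast_ofNat]
  rw [hc]
  congr 1
  linear_combination htrace / 2

end FixedPart

/-! ### The generators -/

section Generators

lemma conjTranspose_mul_deriv_add_eq_zero {n : Type*} [Fintype n] [DecidableEq n]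
    {C : ℝ → Matrix n n ℂ} {C' : Matrix n n ℂ} {x : ℝ}
    (hC : ∀ i j, HasDerivAt (fun s => C s i j) (C' i j) x)
    (hunitary : ∀ s, C s ∈ unitaryGroup n ℂ) : (C x)ᴴ * C' + C'ᴴ * C x = 0 := by
  ext i j
  have hentry : HasDerivAt (fun s => ((C s)ᴴ * C s) i j) (((C x)ᴴ * C' + C'ᴴ * C x) i j) x := by
    simp only [Matrix.mul_apply, Matrix.add_apply, conjTranspose_apply, ← Finset.sum_add_distrib]
    refine HasDerivAt.fun_sum fun l _ => ?_
    rw [add_comm]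
    exact (hC l i).star.mul (hC l j)
  have hconst : (fun s => ((C s)ᴴ * C s) i j) = fun _ => (1 : Matrix n n ℂ) i j := by
    ext s
    rw [← star_eq_conjTranspose, mem_unitaryGroup_iff'.mp (hunitary s)]
  exact (hconst ▸ hentry).unique (hasDerivAt_const _ _)

lemma trace_adjugate_mul_deriv_eq_zero {C : ℝ → Matrix (Fin 2) (Fin 2) ℂ}
    {C' : Matrix (Fin 2) (Fin 2) ℂ} {x : ℝ} {d : ℂ}
    (hC : ∀ i j, HasDerivAt (fun s => C s i j) (C' i j) x)
    (hdet : ∀ s, (C s).det = d) : ((C x).adjugate * C').trace = 0 := by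
  have hderiv := ((hC 0 0).fun_mul (hC 1 1)).fun_sub ((hC 0 1).fun_mul (hC 1 0))
  have hconst : (fun s => C s 0 0 * C s 1 1 - C s 0 1 * C s 1 0) = fun _ => d := by
    ext s
    rw [← det_fin_two, hdet]
  have hzero := HasDerivAt.unique (hconst ▸ hderiv) (hasDerivAt_const _ _)
  simp only [adjugate_fin_two, trace_fin_two, Matrix.mul_apply, Fin.sum_univ_two, of_apply,
    cons_val]
  linear_combination hzero

/-- The partial derivative `∂_μ C_Θ` of the coin matrix. -/
noncomputable def coinDeriv (Θ : Params) (μ : CoinParam) : Matrix (Fin 2) (Fin 2) ℂ :=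
  Matrix.of fun i j => deriv (fun s : ℝ => coin (Function.update Θ μ s) i j) (Θ μ)

lemma differentiable_coin {Θ : ℝ → Params} (hΘ : ∀ ν, Differentiable ℝ (fun s => Θ s ν))
    (i j : Fin 2) : Differentiable ℝ (fun s => coin (Θ s) i j) := by
  have hparam : ∀ ν, Differentiable ℝ (fun s => (Θ s ν : ℂ)) := fun ν =>
    Complex.ofRealCLM.differentiable.comp (hΘ ν)
  have hcos : Differentiable ℝ (fun s => (Real.cos (Θ s .theta) : ℂ)) :=
    Complex.ofRealCLM.differentiable.comp (hΘ .theta).cos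
  have hsin : Differentiable ℝ (fun s => (Real.sin (Θ s .theta) : ℂ)) :=
    Complex.ofRealCLM.differentiable.comp (hΘ .theta).sin
  have hexp : ∀ ν, Differentiable ℝ (fun s => Complex.exp (Complex.I * Θ s ν)) := fun ν =>
    ((hparam ν).const_mul Complex.I).cexp
  have hexp_neg : ∀ ν, Differentiable ℝ (fun s => Complex.exp (-(Complex.I * Θ s ν))) :=
    fun ν => ((hparam ν).const_mul Complex.I).fun_neg.cexp
  fin_cases i <;> fin_cases j
  · exact (hexp .alpha).mul hcos
  · exact (hexp .beta).mul hsin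
  · exact ((hexp_neg .beta).mul hsin).neg
  · exact (hexp_neg .alpha).mul hcos

lemma hasDerivAt_coin (Θ : Params) (μ : CoinParam) (i j : Fin 2) :
    HasDerivAt (fun s : ℝ => coin (Function.update Θ μ s) i j) (coinDeriv Θ μ i j) (Θ μ) := by
  have hupdate : ∀ ν, Differentiable ℝ (fun s => Function.update Θ μ s ν) :=
    differentiable_pi.mp fun s => (hasFDerivAt_update Θ s).differentiableAt
  exact (differentiable_coin hupdate i j).differentiableAt.hasDerivAt

variable (k : ℝ) (Θ : Params) (μ : CoinParam)

lemma genAt_eq_conjTranspose_mul :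
    genAt k Θ μ = (stepAt k Θ)ᴴ * (shiftAt k * coinDeriv Θ μ) := by
  rw [genAt]
  congr 1
  ext i j
  simp only [stepAt, shiftAt, diagonal_mul, of_apply]
  exact ((hasDerivAt_coin Θ μ i j).const_mul _).deriv

lemma shiftAt_mul_coinDeriv : shiftAt k * coinDeriv Θ μ = stepAt k Θ * genAt k Θ μ := by
  have hu : stepAt k Θ * (stepAt k Θ)ᴴ = 1 :=
    mem_unitaryGroup_iff.mp (stepAt_mem_unitaryGroup k Θ)
  rw [genAt_eq_conjTranspose_mul, ← Matrix.mul_assoc (stepAt k Θ), hu, Matrix.one_mul]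

lemma genAt_eq_coin : genAt k Θ μ = (coin Θ)ᴴ * coinDeriv Θ μ := by
  have hshift : (shiftAt k)ᴴ * shiftAt k = 1 :=
    mem_unitaryGroup_iff'.mp (shiftAt_mem_unitaryGroup k)
  rw [genAt_eq_conjTranspose_mul, show stepAt k Θ = shiftAt k * coin Θ from rfl,
    conjTranspose_mul, Matrix.mul_assoc, ← Matrix.mul_assoc (shiftAt k)ᴴ, hshift, Matrix.one_mul]

lemma trace_genAt : (genAt k Θ μ).trace = 0 := by
  have h := trace_adjugate_mul_deriv_eq_zero (hasDerivAt_coin Θ μ) fun s => det_coin _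
  rwa [Function.update_eq_self, adjugate_coin, ← genAt_eq_coin k] at h

lemma genAt_conjTranspose : (genAt k Θ μ)ᴴ = -genAt k Θ μ := by
  have h := conjTranspose_mul_deriv_add_eq_zero (hasDerivAt_coin Θ μ) fun s =>
    coin_mem_unitaryGroup _
  rw [Function.update_eq_self, ← genAt_eq_coin k] at h
  rw [eq_neg_iff_add_eq_zero, add_comm, ← h, genAt_eq_coin, conjTranspose_mul,
    conjTranspose_conjTranspose]

end Generators

/-! ### Fourier series on the Brillouin zone -/

section Fourier

/-- Lebesgue measure on the Brillouin zone `(-π, π]`. -/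
noncomputable abbrev zone : Measure ℝ := volume.restrict (Set.Ioc (-π) π)

lemma measurePreserving_neg_coe :
    MeasurePreserving (fun k : ℝ => ((-k : ℝ) : AddCircle (2 * π))) zone volume := by
  have h := AddCircle.measurePreserving_mk (2 * π) (-π)
  rw [show -π + 2 * π = π by ring] at h
  exact (Measure.measurePreserving_neg (volume : Measure (AddCircle (2 * π)))).comp h

lemma ae_zone_of_ae_haarAddCircle {P : AddCircle (2 * π) → Prop}
    (h : ∀ᵐ x ∂(AddCircle.haarAddCircle : Measure (AddCircle (2 * π))), P x) :
    ∀ᵐ k ∂zone, P ((-k : ℝ) : AddCircle (2 * π)) := by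
  refine measurePreserving_neg_coe.quasiMeasurePreserving.ae ?_
  rw [AddCircle.volume_eq_smul_haarAddCircle]
  exact Measure.ae_smul_measure h _

lemma integrable_volume_of_integrable_haarAddCircle {F : AddCircle (2 * π) → ℂ}
    (hF : Integrable F AddCircle.haarAddCircle) : Integrable F volume := by
  rw [AddCircle.volume_eq_smul_haarAddCircle]
  exact hF.smul_measure ENNReal.ofReal_ne_top

lemma integrable_zone_comp_neg_coe {F : AddCircle (2 * π) → ℂ}
    (hF : Integrable F AddCircle.haarAddCircle) :
    Integrable (fun k : ℝ => F ((-k : ℝ) : AddCircle (2 * π))) zone :=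
  measurePreserving_neg_coe.integrable_comp_of_integrable
    (integrable_volume_of_integrable_haarAddCircle hF)

lemma kInt_eq (f : ℝ → ℂ) : kInt f = (2 * π : ℂ)⁻¹ * ∫ k, f k ∂zone := by
  rw [kInt, intervalIntegral.integral_of_le (by linarith [Real.pi_pos])]
  simp_rw [div_eq_inv_mul]
  exact integral_const_mul _ _

lemma kInt_congr_ae {f g : ℝ → ℂ} (h : f =ᵐ[zone] g) : kInt f = kInt g := by
  rw [kInt_eq, kInt_eq, integral_congr_ae h]

lemma kInt_const_mul (c : ℂ) (f : ℝ → ℂ) : kInt (fun k => c * f k) = c * kInt f := by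
  rw [kInt_eq, kInt_eq, integral_const_mul, mul_left_comm]

lemma kInt_comp_neg_coe {F : AddCircle (2 * π) → ℂ} (hF : Integrable F AddCircle.haarAddCircle) :
    kInt (fun k => F ((-k : ℝ) : AddCircle (2 * π))) = ∫ x, F x ∂AddCircle.haarAddCircle := by
  have hmap := integral_map (μ := zone) measurePreserving_neg_coe.measurable.aemeasurable (f := F)
    (by
      rw [measurePreserving_neg_coe.map_eq]
      exact (integrable_volume_of_integrable_haarAddCircle hF).aestronglyMeasurable)
  rw [measurePreserving_neg_coe.map_eq] at hmap
  rw [kInt_eq, ← hmap, AddCircle.integral_haarAddCircle, Complex.real_smul]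
  push_cast
  rfl

/-- The Fourier series `∑ₓ e^{-ikx} f x`, defined for almost every `k`. -/
noncomputable def fourierSeries (f : Position) (k : ℝ) : ℂ :=
  ((fourierBasis (T := 2 * π)).repr.symm f : AddCircle (2 * π) → ℂ)
    ((-k : ℝ) : AddCircle (2 * π))

variable (f g : Position)

lemma fourierSeries_add :
    ∀ᵐ k ∂zone, fourierSeries (f + g) k = fourierSeries f k + fourierSeries g k := by
  have h := Lp.coeFn_add ((fourierBasis (T := 2 * π)).repr.symm f)
    ((fourierBasis (T := 2 * π)).repr.symm g)
  rw [← map_add] at h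
  exact ae_zone_of_ae_haarAddCircle h

lemma fourierSeries_smul (c : ℂ) :
    ∀ᵐ k ∂zone, fourierSeries (c • f) k = c * fourierSeries f k := by
  have h := Lp.coeFn_smul c ((fourierBasis (T := 2 * π)).repr.symm f)
  rw [← map_smul] at h
  exact ae_zone_of_ae_haarAddCircle h

lemma fourier_neg_coe (a : ℤ) (k : ℝ) :
    fourier a ((-k : ℝ) : AddCircle (2 * π)) = Complex.exp (-(Complex.I * (a * k))) := by
  rw [fourier_coe_apply]
  congr 1
  have : (π : ℂ) ≠ 0 := by exact_mod_cast Real.pi_ne_zero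
  push_cast
  field_simp

lemma fourierBasis_repr_symm_latticeTranslate (a : ℤ) :
    (fourierBasis (T := 2 * π)).repr.symm (latticeTranslate a f) =ᵐ[AddCircle.haarAddCircle]
      fun x => fourier a x * (fourierBasis (T := 2 * π)).repr.symm f x := by
  set F := (fourierBasis (T := 2 * π)).repr.symm f with hF
  have hmem : MemLp (fun x : AddCircle (2 * π) => fourier a x * F x) 2
      AddCircle.haarAddCircle := by
    refine (Lp.memLp F).of_le ?_ (ae_of_all _ fun x => ?_)
    · exact (fourier a).continuous.aestronglyMeasurable.mul (Lp.aestronglyMeasurable _)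
    · rw [norm_mul, fourier_apply, Circle.norm_coe, one_mul]
  suffices heq : (fourierBasis (T := 2 * π)).repr.symm (latticeTranslate a f) = hmem.toLp from
    heq ▸ hmem.coeFn_toLp
  rw [LinearIsometryEquiv.symm_apply_eq]
  ext n
  have hcoeff : latticeTranslate a f n = fourierCoeff (T := 2 * π) F (n - a) := by
    rw [← fourierBasis_repr, hF, LinearIsometryEquiv.apply_symm_apply]
    rfl
  rw [fourierBasis_repr, fourierCoeff_congr_ae hmem.coeFn_toLp, hcoeff, fourierCoeff, fourierCoeff]
  refine integral_congr_ae (ae_of_all _ fun x => ?_)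
  simp only [smul_eq_mul, ← mul_assoc, ← fourier_add]
  ring_nf

lemma fourierSeries_latticeTranslate (a : ℤ) :
    ∀ᵐ k ∂zone, fourierSeries (latticeTranslate a f) k =
      Complex.exp (-(Complex.I * (a * k))) * fourierSeries f k := by
  filter_upwards [ae_zone_of_ae_haarAddCircle (fourierBasis_repr_symm_latticeTranslate f a)]
    with k hk
  rw [← fourier_neg_coe]
  exact hk

lemma star_fourierSeries_mul (k : ℝ) :
    star (fourierSeries f k) * fourierSeries g k =
      ⟪(fourierBasis (T := 2 * π)).repr.symm f ((-k : ℝ) : AddCircle (2 * π)),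
        (fourierBasis (T := 2 * π)).repr.symm g ((-k : ℝ) : AddCircle (2 * π))⟫_ℂ :=
  (mul_comm _ _).trans (RCLike.inner_apply _ _).symm

lemma integrable_star_fourierSeries_mul :
    Integrable (fun k => star (fourierSeries f k) * fourierSeries g k) zone := by
  simp_rw [star_fourierSeries_mul]
  exact integrable_zone_comp_neg_coe (L2.integrable_inner (𝕜 := ℂ) _ _)

lemma kInt_star_fourierSeries_mul :
    kInt (fun k => star (fourierSeries f k) * fourierSeries g k) = ⟪f, g⟫_ℂ := by
  simp_rw [star_fourierSeries_mul]
  rw [kInt_comp_neg_coe (L2.integrable_inner (𝕜 := ℂ) _ _), ← L2.inner_def,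
    LinearIsometryEquiv.inner_map_map]

variable (Ψ Φ : Walker)

lemma integrable_star_amplitude_dotProduct :
    Integrable (fun k => star (amplitude Ψ k) ⬝ᵥ amplitude Φ k) zone :=
  integrable_finsetSum _ fun j _ => integrable_star_fourierSeries_mul (Ψ j) (Φ j)

lemma inner_eq_kInt : ⟪Ψ, Φ⟫_ℂ = kInt (fun k => star (amplitude Ψ k) ⬝ᵥ amplitude Φ k) := by
  have hdot : (fun k => star (amplitude Ψ k) ⬝ᵥ amplitude Φ k) =
      fun k => ∑ j, star (fourierSeries (Ψ j) k) * fourierSeries (Φ j) k := rfl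
  rw [kInt_eq, PiLp.inner_apply, hdot,
    integral_finsetSum _ fun j _ => integrable_star_fourierSeries_mul (Ψ j) (Φ j),
    Finset.mul_sum]
  exact Finset.sum_congr rfl fun j _ => by rw [← kInt_star_fourierSeries_mul, kInt_eq]

end Fourier

/-! ### Translation-invariant operators -/

section Symbol

/-- `A` acts in momentum space as multiplication by the matrix-valued function `M`. -/
def HasSymbol (A : Walker →L[ℂ] Walker) (M : ℝ → Matrix (Fin 2) (Fin 2) ℂ) : Prop :=
  ∀ Ψ, ∀ᵐ k ∂zone, amplitude (A Ψ) k = M k *ᵥ amplitude Ψ k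

variable {A B : Walker →L[ℂ] Walker} {M N : ℝ → Matrix (Fin 2) (Fin 2) ℂ}

lemma amplitude_add (Ψ Φ : Walker) :
    ∀ᵐ k ∂zone, amplitude (Ψ + Φ) k = amplitude Ψ k + amplitude Φ k := by
  filter_upwards [ae_all_iff.mpr fun j => fourierSeries_add (Ψ j) (Φ j)] with k hk
  exact funext hk

lemma amplitude_smul (c : ℂ) (Ψ : Walker) :
    ∀ᵐ k ∂zone, amplitude (c • Ψ) k = c • amplitude Ψ k := by
  filter_upwards [ae_all_iff.mpr fun j => fourierSeries_smul (Ψ j) c] with k hk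
  exact funext hk

lemma HasSymbol.mul (hA : HasSymbol A M) (hB : HasSymbol B N) :
    HasSymbol (A * B) (fun k => M k * N k) := fun Ψ => by
  filter_upwards [hA (B Ψ), hB Ψ] with k hAk hBk
  rw [mul_apply_eq_comp, hAk, hBk, mulVec_mulVec]

lemma HasSymbol.add (hA : HasSymbol A M) (hB : HasSymbol B N) :
    HasSymbol (A + B) (fun k => M k + N k) := fun Ψ => by
  filter_upwards [amplitude_add (A Ψ) (B Ψ), hA Ψ, hB Ψ] with k hadd hAk hBk
  rw [_root_.add_apply, hadd, hAk, hBk, add_mulVec]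

lemma HasSymbol.smul (hA : HasSymbol A M) (c : ℂ) : HasSymbol (c • A) (fun k => c • M k) :=
  fun Ψ => by
    filter_upwards [amplitude_smul c (A Ψ), hA Ψ] with k hsmul hAk
    rw [_root_.smul_apply, hsmul, hAk, smul_mulVec]

lemma hasSymbol_one : HasSymbol 1 (fun _ => 1) := fun _ =>
  ae_of_all _ fun _ => (one_mulVec _).symm

lemma HasSymbol.pow (hA : HasSymbol A M) (t : ℕ) : HasSymbol (A ^ t) (fun k => M k ^ t) := by
  induction t with
  | zero => simpa only [pow_zero] using hasSymbol_one
  | succ t ih => simpa only [pow_succ] using ih.mul hA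

lemma HasSymbol.sum {ι : Type*} {s : Finset ι} {A : ι → Walker →L[ℂ] Walker}
    {M : ι → ℝ → Matrix (Fin 2) (Fin 2) ℂ} (h : ∀ i, HasSymbol (A i) (M i)) :
    HasSymbol (∑ i ∈ s, A i) (fun k => ∑ i ∈ s, M i k) := by
  classical
  induction s using Finset.induction_on with
  | empty =>
    have hzero := hasSymbol_one.smul 0
    rw [_root_.zero_smul ℂ (1 : Walker →L[ℂ] Walker)] at hzero
    simpa only [zero_smul, Finset.sum_empty] using hzero
  | insert i s hi ih => simpa only [Finset.sum_insert hi] using (h i).add ih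

lemma coinOp_apply (C : Matrix (Fin 2) (Fin 2) ℂ) (Ψ : Walker) (i : Fin 2) :
    coinOp C Ψ i = C i 0 • Ψ 0 + C i 1 • Ψ 1 := by
  simp [coinOp, Fin.sum_univ_two]

lemma shiftOp_apply (Ψ : Walker) (i : Fin 2) :
    shiftOp Ψ i = latticeTranslate (![1, -1] i) (Ψ i) := by
  simp [shiftOp]

lemma hasSymbol_coinOp (C : Matrix (Fin 2) (Fin 2) ℂ) : HasSymbol (coinOp C) (fun _ => C) :=
  fun Ψ => by
    filter_upwards [ae_all_iff.mpr fun i => fourierSeries_add (C i 0 • Ψ 0) (C i 1 • Ψ 1),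
      ae_all_iff.mpr fun i => fourierSeries_smul (Ψ 0) (C i 0),
      ae_all_iff.mpr fun i => fourierSeries_smul (Ψ 1) (C i 1)] with k hadd hsmul₀ hsmul₁
    ext i
    change fourierSeries (coinOp C Ψ i) k = _
    rw [coinOp_apply, hadd, hsmul₀, hsmul₁, mulVec, dotProduct, Fin.sum_univ_two]
    rfl

lemma hasSymbol_shiftOp : HasSymbol shiftOp shiftAt := fun Ψ => by
  filter_upwards [ae_all_iff.mpr fun i =>
    fourierSeries_latticeTranslate (Ψ i) (![1, -1] i)] with k hk
  ext i
  change fourierSeries (shiftOp Ψ i) k = _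
  rw [shiftOp_apply, hk, shiftAt, mulVec_diagonal]
  fin_cases i <;> simp [amplitude, fourierSeries]

lemma hasSymbol_evolution (Θ : Params) : HasSymbol (evolution Θ) (stepAt · Θ) :=
  hasSymbol_shiftOp.mul (hasSymbol_coinOp (coin Θ))

end Symbol

section SymbolInner

open scoped Matrix.Norms.L2Operator

variable {A B : Walker →L[ℂ] Walker} {M N : ℝ → Matrix (Fin 2) (Fin 2) ℂ}

lemma star_mulVec_dotProduct_mulVec {n : Type*} [Fintype n] (P Q : Matrix n n ℂ) (v w : n → ℂ) :
    star (P *ᵥ v) ⬝ᵥ (Q *ᵥ w) = star v ⬝ᵥ ((Pᴴ * Q) *ᵥ w) := by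
  rw [star_mulVec, ← dotProduct_mulVec, mulVec_mulVec]

lemma HasSymbol.star_amplitude_dotProduct (hA : HasSymbol A M) (hB : HasSymbol B N)
    (Ψ Φ : Walker) :
    (fun k => star (amplitude (A Ψ) k) ⬝ᵥ amplitude (B Φ) k) =ᵐ[zone]
      fun k => star (amplitude Ψ k) ⬝ᵥ (((M k)ᴴ * N k) *ᵥ amplitude Φ k) := by
  filter_upwards [hA Ψ, hB Φ] with k hAk hBk
  rw [hAk, hBk, star_mulVec_dotProduct_mulVec]

lemma HasSymbol.inner_apply (hA : HasSymbol A M) (hB : HasSymbol B N) (Ψ Φ : Walker) :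
    ⟪A Ψ, B Φ⟫_ℂ = kInt (fun k => star (amplitude Ψ k) ⬝ᵥ (((M k)ᴴ * N k) *ᵥ amplitude Φ k)) := by
  rw [inner_eq_kInt, kInt_congr_ae (hA.star_amplitude_dotProduct hB Ψ Φ)]

lemma HasSymbol.integrable (hA : HasSymbol A M) (hB : HasSymbol B N) (Ψ Φ : Walker) :
    Integrable (fun k => star (amplitude Ψ k) ⬝ᵥ (((M k)ᴴ * N k) *ᵥ amplitude Φ k)) zone :=
  (integrable_star_amplitude_dotProduct (A Ψ) (B Φ)).congr (hA.star_amplitude_dotProduct hB Ψ Φ)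

lemma HasSymbol.norm_apply (hA : HasSymbol A M) (hM : ∀ k, M k ∈ unitaryGroup (Fin 2) ℂ)
    (Ψ : Walker) : ‖A Ψ‖ = ‖Ψ‖ := by
  have hinner : ⟪A Ψ, A Ψ⟫_ℂ = ⟪Ψ, Ψ⟫_ℂ := by
    rw [hA.inner_apply hA, inner_eq_kInt]
    simp_rw [← star_eq_conjTranspose, mem_unitaryGroup_iff'.mp (hM _), one_mulVec]
  rw [@norm_eq_sqrt_re_inner ℂ, hinner, ← @norm_eq_sqrt_re_inner ℂ]

lemma norm_star_dotProduct_mulVec_le {n : Type*} [Fintype n] [DecidableEq n] (P : Matrix n n ℂ)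
    (v : n → ℂ) : ‖star v ⬝ᵥ (P *ᵥ v)‖ ≤ ‖P‖ * ‖star v ⬝ᵥ v‖ := by
  have hinner : ∀ w : n → ℂ, star v ⬝ᵥ w = ⟪WithLp.toLp 2 v, WithLp.toLp 2 w⟫_ℂ := fun w => by
    rw [EuclideanSpace.inner_toLp_toLp, dotProduct_comm]
  rw [hinner, hinner, ← inner_self_re_eq_norm, inner_self_eq_norm_sq]
  calc ‖⟪WithLp.toLp 2 v, WithLp.toLp 2 (P *ᵥ v)⟫_ℂ‖
      ≤ ‖WithLp.toLp 2 v‖ * ‖WithLp.toLp 2 (P *ᵥ v)‖ := norm_inner_le_norm _ _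
    _ ≤ ‖WithLp.toLp 2 v‖ * (‖P‖ * ‖WithLp.toLp 2 v‖) := by
      gcongr
      exact l2_opNorm_mulVec P (WithLp.toLp 2 v)
    _ = ‖P‖ * ‖WithLp.toLp 2 v‖ ^ 2 := by ring

lemma star_amplitude_dotProduct_mulVec (Ψ : Walker) (k : ℝ) (P : Matrix (Fin 2) (Fin 2) ℂ) :
    star (amplitude Ψ k) ⬝ᵥ (P *ᵥ amplitude Ψ k) = (rhoZero Ψ k * P).trace := by
  rw [rhoZero, trace_mul_comm, mul_vecMulVec, trace_vecMulVec, dotProduct_comm]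

variable {A B : ℕ → Walker →L[ℂ] Walker} {M N : ℕ → ℝ → Matrix (Fin 2) (Fin 2) ℂ}

lemma tendsto_inner_of_hasSymbol {P : ℝ → Matrix (Fin 2) (Fin 2) ℂ} {C : ℝ}
    (hA : ∀ t, HasSymbol (A t) (M t)) (hB : ∀ t, HasSymbol (B t) (N t))
    (hbound : ∀ t k, ‖(M t k)ᴴ * N t k‖ ≤ C)
    (hlim : ∀ k, Tendsto (fun t => (M t k)ᴴ * N t k) atTop (𝓝 (P k))) (Ψ : Walker) :
    Tendsto (fun t => ⟪A t Ψ, B t Ψ⟫_ℂ) atTop (𝓝 (kInt fun k => (rhoZero Ψ k * P k).trace)) := by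
  simp_rw [fun t => (hA t).inner_apply (hB t) Ψ Ψ, ← star_amplitude_dotProduct_mulVec, kInt_eq]
  refine Tendsto.const_mul _ (tendsto_integral_of_dominated_convergence
    (fun k => C * ‖star (amplitude Ψ k) ⬝ᵥ amplitude Ψ k‖)
    (fun t => ((hA t).integrable (hB t) Ψ Ψ).aestronglyMeasurable)
    ((integrable_star_amplitude_dotProduct Ψ Ψ).norm.const_mul C)
    (fun t => ae_of_all _ fun k => ?_) (ae_of_all _ fun k => ?_))
  · exact (norm_star_dotProduct_mulVec_le _ _).trans
      (mul_le_mul_of_nonneg_right (hbound t k) (norm_nonneg _))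
  · have hcont : Continuous fun Q : Matrix (Fin 2) (Fin 2) ℂ =>
        star (amplitude Ψ k) ⬝ᵥ (Q *ᵥ amplitude Ψ k) := by fun_prop
    exact (hcont.tendsto _).comp (hlim k)

lemma tendsto_inner_of_hasSymbol_unitary_mul {u X Y : ℕ → ℝ → Matrix (Fin 2) (Fin 2) ℂ}
    {X' Y' : ℝ → Matrix (Fin 2) (Fin 2) ℂ} {a b : ℝ}
    (hu : ∀ t k, u t k ∈ unitaryGroup (Fin 2) ℂ)
    (hA : ∀ t, HasSymbol (A t) (fun k => u t k * X t k))
    (hB : ∀ t, HasSymbol (B t) (fun k => u t k * Y t k))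
    (hXa : ∀ t k, ‖X t k‖ ≤ a) (hYb : ∀ t k, ‖Y t k‖ ≤ b)
    (hX : ∀ k, Tendsto (fun t => X t k) atTop (𝓝 (X' k)))
    (hY : ∀ k, Tendsto (fun t => Y t k) atTop (𝓝 (Y' k))) (Ψ : Walker) :
    Tendsto (fun t => ⟪A t Ψ, B t Ψ⟫_ℂ) atTop
      (𝓝 (kInt fun k => (rhoZero Ψ k * ((X' k)ᴴ * Y' k)).trace)) := by
  have hcancel : ∀ t k, (u t k * X t k)ᴴ * (u t k * Y t k) = (X t k)ᴴ * Y t k := fun t k => by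
    rw [conjTranspose_mul, Matrix.mul_assoc, ← Matrix.mul_assoc (u t k)ᴴ,
      ← star_eq_conjTranspose (u t k), mem_unitaryGroup_iff'.mp (hu t k), Matrix.one_mul]
  refine tendsto_inner_of_hasSymbol (C := a * b) hA hB (fun t k => ?_) (fun k => ?_) Ψ
  · rw [hcancel]
    refine (norm_mul_le _ _).trans ?_
    rw [l2_opNorm_conjTranspose]
    exact mul_le_mul (hXa t k) (hYb t k) (norm_nonneg _) ((norm_nonneg _).trans (hXa t k))
  · simp_rw [hcancel]
    exact ((continuous_id.matrix_conjTranspose.tendsto _).comp (hX k)).mul (hY k)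

end SymbolInner

/-! ### The derivative of the evolution -/

section EvolutionDeriv

lemma coinOp_eq_sum (C : Matrix (Fin 2) (Fin 2) ℂ) :
    coinOp C = ∑ i, ∑ j, C i j • coinOp (Matrix.single i j 1) := by
  ext Ψ i x
  fin_cases i <;>
    simp [coinOp, Fin.sum_univ_two, Matrix.single_apply]

lemma hasDerivAt_coinOp {C : ℝ → Matrix (Fin 2) (Fin 2) ℂ} {C' : Matrix (Fin 2) (Fin 2) ℂ} {x : ℝ}
    (hC : ∀ i j, HasDerivAt (fun s => C s i j) (C' i j) x) :
    HasDerivAt (fun s => coinOp (C s)) (coinOp C') x := by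
  simp_rw [coinOp_eq_sum (C _), coinOp_eq_sum C']
  exact HasDerivAt.fun_sum fun i _ => HasDerivAt.fun_sum fun j _ =>
    (hC i j).smul_const (coinOp (Matrix.single i j 1))

variable (Θ : Params) (μ : CoinParam)

lemma hasDerivAt_evolution :
    HasDerivAt (fun s : ℝ => evolution (Function.update Θ μ s))
      (shiftOp * coinOp (coinDeriv Θ μ)) (Θ μ) :=
  (hasDerivAt_coinOp (hasDerivAt_coin Θ μ)).const_mul shiftOp

/-- The partial derivative `∂_μ (U_Θ^t)`. -/
noncomputable def evolutionPowDeriv (t : ℕ) : Walker →L[ℂ] Walker :=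
  ∑ s ∈ Finset.range t,
    evolution Θ ^ (t.pred - s) * (shiftOp * coinOp (coinDeriv Θ μ)) * evolution Θ ^ s

lemma hasDerivAt_stateAt (Ψ₀ : Walker) (t : ℕ) :
    HasDerivAt (fun s : ℝ => stateAt Ψ₀ t (Function.update Θ μ s))
      (evolutionPowDeriv Θ μ t Ψ₀) (Θ μ) := by
  have hpow := (hasDerivAt_evolution Θ μ).fun_pow' t
  rw [Function.update_eq_self] at hpow
  exact ((ContinuousLinearMap.apply ℂ Walker Ψ₀).restrictScalars ℝ).hasFDerivAt.comp_hasDerivAt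
    _ hpow

lemma hasSymbol_evolutionPow (t : ℕ) : HasSymbol (evolution Θ ^ t) (fun k => stepAt k Θ ^ t) :=
  (hasSymbol_evolution Θ).pow t

lemma norm_stateAt (Ψ₀ : Walker) (t : ℕ) : ‖stateAt Ψ₀ t Θ‖ = ‖Ψ₀‖ :=
  (hasSymbol_evolutionPow Θ t).norm_apply (fun k => pow_mem (stepAt_mem_unitaryGroup k Θ) t) Ψ₀

lemma hasSymbol_smul_evolutionPowDeriv (t : ℕ) :
    HasSymbol ((t : ℂ)⁻¹ • evolutionPowDeriv Θ μ t)
      (fun k => stepAt k Θ ^ t * orbitAverage (stepAt k Θ) (genAt k Θ μ) t) := by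
  simp_rw [fun k => pow_mul_orbitAverage (stepAt_mem_unitaryGroup k Θ), ← shiftAt_mul_coinDeriv]
  exact (HasSymbol.sum fun s => ((hasSymbol_evolutionPow Θ _).mul
    (hasSymbol_shiftOp.mul (hasSymbol_coinOp _))).mul (hasSymbol_evolutionPow Θ s)).smul _

end EvolutionDeriv

/-! ### Long-time asymptotics -/

section Asymptotics

open scoped Matrix.Norms.L2Operator

variable {Θ : Params} (Ψ₀ : Walker) (μ ν : CoinParam)

/-- The limit of `F_{μν}(t) / t²`. -/
noncomputable def asymptoticFisher (Θ : Params) : ℂ :=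
  kInt (fun k => (rhoZero Ψ₀ k).trace * form k Θ (genAt k Θ μ) (genAt k Θ ν)) -
    kInt (fun k => form k Θ (genAt k Θ μ) (rhoZero Ψ₀ k)) *
      kInt (fun k => form k Θ (rhoZero Ψ₀ k) (genAt k Θ ν))

lemma form_neg (k : ℝ) (A B : Matrix (Fin 2) (Fin 2) ℂ) : form k Θ (-A) B = -form k Θ A B := by
  rw [form, form, bloch_neg, star_neg, neg_dotProduct]

lemma form_neg_right (k : ℝ) (A B : Matrix (Fin 2) (Fin 2) ℂ) :
    form k Θ A (-B) = -form k Θ A B := by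
  rw [form, form, bloch_neg, mulVec_neg, dotProduct_neg]

lemma rhoZero_conjTranspose (k : ℝ) : (rhoZero Ψ₀ k)ᴴ = rhoZero Ψ₀ k := by
  rw [rhoZero, conjTranspose_vecMulVec, star_star]

lemma form_genAt_comm (k : ℝ) :
    form k Θ (genAt k Θ μ) (genAt k Θ ν) = form k Θ (genAt k Θ ν) (genAt k Θ μ) := by
  rw [← form_conjTranspose, genAt_conjTranspose, genAt_conjTranspose, form_neg, form_neg_right,
    neg_neg]

lemma form_genAt_rhoZero (k : ℝ) :
    form k Θ (genAt k Θ μ) (rhoZero Ψ₀ k) = -form k Θ (rhoZero Ψ₀ k) (genAt k Θ μ) := by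
  rw [← form_conjTranspose, genAt_conjTranspose, rhoZero_conjTranspose, form_neg_right]

lemma asymptoticFisher_comm : asymptoticFisher Ψ₀ μ ν Θ = asymptoticFisher Ψ₀ ν μ Θ := by
  simp only [asymptoticFisher, form_genAt_comm μ ν, form_genAt_rhoZero,
    ← neg_one_mul (form _ _ _ _), kInt_const_mul]
  ring

lemma norm_orbitAverage_genAt_le (t : ℕ) (k : ℝ) :
    ‖orbitAverage (stepAt k Θ) (genAt k Θ μ) t‖ ≤ ‖(coin Θ)ᴴ * coinDeriv Θ μ‖ :=
  (norm_orbitAverage_le (stepAt_mem_unitaryGroup k Θ) _ t).trans_eq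
    (congrArg norm (genAt_eq_coin k Θ μ))

lemma tendsto_inner_evolutionPowDeriv (hθ : Real.sin (Θ .theta) ≠ 0) :
    Tendsto (fun t : ℕ => ⟪((t : ℂ)⁻¹ • evolutionPowDeriv Θ μ t) Ψ₀,
        ((t : ℂ)⁻¹ • evolutionPowDeriv Θ ν t) Ψ₀⟫_ℂ) atTop
      (𝓝 (1 / 4 * kInt (fun k => (rhoZero Ψ₀ k).trace *
        form k Θ (genAt k Θ μ) (genAt k Θ ν)))) := by
  have hlim := tendsto_inner_of_hasSymbol_unitary_mul
    (fun t k => pow_mem (stepAt_mem_unitaryGroup k Θ) t)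
    (hasSymbol_smul_evolutionPowDeriv Θ μ) (hasSymbol_smul_evolutionPowDeriv Θ ν)
    (norm_orbitAverage_genAt_le μ) (norm_orbitAverage_genAt_le ν)
    (fun k => tendsto_orbitAverage_stepAt k hθ _) (fun k => tendsto_orbitAverage_stepAt k hθ _) Ψ₀
  simp_rw [fun k => fixedPart_conjTranspose_mul_fixedPart k hθ (trace_genAt k Θ μ)
    (trace_genAt k Θ ν), Matrix.mul_smul, Matrix.mul_one, trace_smul, smul_eq_mul, mul_assoc,
    kInt_const_mul] at hlim
  simpa only [mul_comm (rhoZero Ψ₀ _).trace] using hlim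

lemma hasSymbol_evolutionPow_mul_one (t : ℕ) :
    HasSymbol (evolution Θ ^ t) (fun k => stepAt k Θ ^ t * 1) := by
  simpa only [Matrix.mul_one] using hasSymbol_evolutionPow Θ t

lemma tendsto_inner_evolutionPowDeriv_stateAt (hθ : Real.sin (Θ .theta) ≠ 0) :
    Tendsto (fun t : ℕ => ⟪((t : ℂ)⁻¹ • evolutionPowDeriv Θ μ t) Ψ₀, stateAt Ψ₀ t Θ⟫_ℂ) atTop
      (𝓝 (1 / 2 * kInt (fun k => form k Θ (genAt k Θ μ) (rhoZero Ψ₀ k)))) := by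
  have hlim := tendsto_inner_of_hasSymbol_unitary_mul
    (fun t k => pow_mem (stepAt_mem_unitaryGroup k Θ) t)
    (hasSymbol_smul_evolutionPowDeriv Θ μ) hasSymbol_evolutionPow_mul_one
    (norm_orbitAverage_genAt_le μ) (fun _ _ => le_rfl)
    (fun k => tendsto_orbitAverage_stepAt k hθ _) (fun _ => tendsto_const_nhds) Ψ₀
  simp_rw [Matrix.mul_one, trace_mul_comm (rhoZero Ψ₀ _), trace_fixedPart_conjTranspose_mul,
    kInt_const_mul] at hlim
  exact hlim

lemma tendsto_inner_stateAt_evolutionPowDeriv (hθ : Real.sin (Θ .theta) ≠ 0) :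
    Tendsto (fun t : ℕ => ⟪stateAt Ψ₀ t Θ, ((t : ℂ)⁻¹ • evolutionPowDeriv Θ ν t) Ψ₀⟫_ℂ) atTop
      (𝓝 (1 / 2 * kInt (fun k => form k Θ (rhoZero Ψ₀ k) (genAt k Θ ν)))) := by
  have hlim := tendsto_inner_of_hasSymbol_unitary_mul
    (fun t k => pow_mem (stepAt_mem_unitaryGroup k Θ) t)
    hasSymbol_evolutionPow_mul_one (hasSymbol_smul_evolutionPowDeriv Θ ν)
    (fun _ _ => le_rfl) (norm_orbitAverage_genAt_le ν)
    (fun _ => tendsto_const_nhds) (fun k => tendsto_orbitAverage_stepAt k hθ _) Ψ₀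
  simp_rw [← kInt_const_mul, ← trace_conjTranspose_mul_fixedPart, rhoZero_conjTranspose]
  simpa only [conjTranspose_one, Matrix.one_mul, stateAt] using hlim

lemma geometricTensor_div_sq (ψ χ₁ χ₂ : Walker) (t : ℕ) :
    geometricTensor ψ χ₁ χ₂ / (t : ℂ) ^ 2 =
      geometricTensor ψ ((t : ℂ)⁻¹ • χ₁) ((t : ℂ)⁻¹ • χ₂) := by
  simp only [geometricTensor, inner_smul_left, inner_smul_right, map_inv₀, Complex.conj_natCast]
  ring

lemma tendsto_geometricTensor (hθ : Real.sin (Θ .theta) ≠ 0) :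
    Tendsto (fun t : ℕ => geometricTensor (stateAt Ψ₀ t Θ) (evolutionPowDeriv Θ μ t Ψ₀)
        (evolutionPowDeriv Θ ν t Ψ₀) / (t : ℂ) ^ 2) atTop
      (𝓝 (asymptoticFisher Ψ₀ μ ν Θ)) := by
  have hlim := ((tendsto_inner_evolutionPowDeriv Ψ₀ μ ν hθ).sub
    ((tendsto_inner_evolutionPowDeriv_stateAt Ψ₀ μ hθ).mul
      (tendsto_inner_stateAt_evolutionPowDeriv Ψ₀ ν hθ))).const_mul 4
  simp_rw [geometricTensor_div_sq, asymptoticFisher]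
  convert! hlim using 2
  ring

variable {μ ν}

section SLD

variable (hΨ : ‖Ψ₀‖ = 1)

include hΨ

lemma norm_stateAt_eq_one (t : ℕ) (Θ : Params) : ‖stateAt Ψ₀ t Θ‖ = 1 :=
  (norm_stateAt Θ Ψ₀ t).trans hΨ

lemma exists_isSLD_densityAt (t : ℕ) : ∃ L, IsSLD (densityAt Ψ₀ t) Θ μ L :=
  ⟨_, isSLD_rankOne (norm_stateAt_eq_one Ψ₀ hΨ t) (hasDerivAt_stateAt Θ μ Ψ₀ t)⟩

variable {L M : ℕ → Walker →L[ℂ] Walker} (hθ : Real.sin (Θ .theta) ≠ 0)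
  (hL : ∀ t, IsSLD (densityAt Ψ₀ t) Θ μ (L t)) (hM : ∀ t, IsSLD (densityAt Ψ₀ t) Θ ν (M t))

include hθ hL hM

theorem tendsto_qfi_div_sq :
    Tendsto (fun t : ℕ => qfi (densityAt Ψ₀ t Θ) (L t) (M t) / (t : ℂ) ^ 2) atTop
      (𝓝 (asymptoticFisher Ψ₀ μ ν Θ)) := by
  have hlim := ((tendsto_geometricTensor Ψ₀ μ ν hθ).add
    (tendsto_geometricTensor Ψ₀ ν μ hθ)).const_mul (1 / 2)
  rw [asymptoticFisher_comm Ψ₀ ν μ, ← two_mul, ← mul_assoc, one_div_mul_cancel two_ne_zero,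
    one_mul] at hlim
  refine hlim.congr fun t => ?_
  rw [densityAt, qfi_eq_geometricTensor (norm_stateAt_eq_one Ψ₀ hΨ t) (hL t) (hM t)
    (hasDerivAt_stateAt Θ μ Ψ₀ t) (hasDerivAt_stateAt Θ ν Ψ₀ t), ← add_div, mul_div_assoc]

theorem tendsto_uhlmann_div_sq :
    Tendsto (fun t : ℕ => uhlmann (densityAt Ψ₀ t Θ) (L t) (M t) / (t : ℂ) ^ 2) atTop (𝓝 0) := by
  have hlim := ((tendsto_geometricTensor Ψ₀ μ ν hθ).sub
    (tendsto_geometricTensor Ψ₀ ν μ hθ)).const_mul (-(Complex.I / 2))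
  rw [asymptoticFisher_comm Ψ₀ ν μ, sub_self, mul_zero] at hlim
  refine hlim.congr fun t => ?_
  rw [densityAt, uhlmann_eq_geometricTensor (norm_stateAt_eq_one Ψ₀ hΨ t) (hL t) (hM t)
    (hasDerivAt_stateAt Θ μ Ψ₀ t) (hasDerivAt_stateAt Θ ν Ψ₀ t), ← sub_div, mul_div_assoc]

end SLD

end Asymptotics

end QWalk

theorem theorem1 (Θ : QWalk.Params) (hθ : Real.sin (Θ .theta) ≠ 0)
    (Ψ₀ : QWalk.Walker) (hΨ : ‖Ψ₀‖ = 1) :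
    -- `A_k^𝟙` is the orthogonal projector onto the eigenvalue-1 eigenspace of the superoperator
    (∀ k : ℝ, (QWalk.projOne k Θ).IsHermitian ∧
      QWalk.projOne k Θ * QWalk.projOne k Θ = QWalk.projOne k Θ ∧
      ∀ v : Fin 4 → ℂ,
        QWalk.projOne k Θ *ᵥ v = v ↔ QWalk.superop k Θ *ᵥ v = v) ∧
    -- symmetric logarithmic derivatives exist
    (∀ (t : ℕ) (μ : QWalk.CoinParam), ∃ L : QWalk.Walker →L[ℂ] QWalk.Walker,
      QWalk.IsSLD (QWalk.densityAt Ψ₀ t) Θ μ L) ∧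
    -- the asymptotics, for every choice of symmetric logarithmic derivatives
    ∀ L : ℕ → QWalk.CoinParam → QWalk.Walker →L[ℂ] QWalk.Walker,
      (∀ t μ, QWalk.IsSLD (QWalk.densityAt Ψ₀ t) Θ μ (L t μ)) →
      ∀ μ ν : QWalk.CoinParam,
        -- arbitrary initial state
        Tendsto
          (fun t : ℕ => QWalk.qfi (QWalk.densityAt Ψ₀ t Θ) (L t μ) (L t ν) / (t : ℂ) ^ 2) atTop
          (𝓝 (QWalk.kInt (fun k => (QWalk.rhoZero Ψ₀ k).trace *
                QWalk.form k Θ (QWalk.genAt k Θ μ) (QWalk.genAt k Θ ν)) -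
              QWalk.kInt (fun k => QWalk.form k Θ (QWalk.genAt k Θ μ) (QWalk.rhoZero Ψ₀ k)) *
              QWalk.kInt (fun k => QWalk.form k Θ (QWalk.rhoZero Ψ₀ k) (QWalk.genAt k Θ ν)))) ∧
        -- initial state for which `ϱ₀` has trace one at almost every `k`
        ((∀ᵐ k ∂(volume.restrict (Set.Ioc (-π) π)), (QWalk.rhoZero Ψ₀ k).trace = 1) →
          Tendsto
            (fun t : ℕ => QWalk.qfi (QWalk.densityAt Ψ₀ t Θ) (L t μ) (L t ν) / (t : ℂ) ^ 2) atTop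
            (𝓝 (QWalk.kInt (fun k => QWalk.form k Θ (QWalk.genAt k Θ μ) (QWalk.genAt k Θ ν)) -
                QWalk.kInt (fun k => QWalk.form k Θ (QWalk.genAt k Θ μ) (QWalk.rhoZero Ψ₀ k)) *
                QWalk.kInt (fun k =>
                  QWalk.form k Θ (QWalk.rhoZero Ψ₀ k) (QWalk.genAt k Θ ν))))) ∧
        Tendsto
          (fun t : ℕ => QWalk.uhlmann (QWalk.densityAt Ψ₀ t Θ) (L t μ) (L t ν) / (t : ℂ) ^ 2) atTop
          (𝓝 0) := by
  refine ⟨fun k => ⟨QWalk.projOne_isHermitian k, (QWalk.isStarProjection_projOne k hθ).1.eq,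
      QWalk.projOne_mulVec_eq_self_iff_superop k hθ⟩,
    fun t μ => QWalk.exists_isSLD_densityAt Ψ₀ hΨ t, fun L hL μ ν => ?_⟩
  have hqfi := QWalk.tendsto_qfi_div_sq Ψ₀ hΨ hθ (fun t => hL t μ) (fun t => hL t ν)
  refine ⟨hqfi, fun htrace => ?_,
    QWalk.tendsto_uhlmann_div_sq Ψ₀ hΨ hθ (fun t => hL t μ) (fun t => hL t ν)⟩
  have hweight : QWalk.kInt (fun k => (QWalk.rhoZero Ψ₀ k).trace *
        QWalk.form k Θ (QWalk.genAt k Θ μ) (QWalk.genAt k Θ ν)) =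
      QWalk.kInt (fun k => QWalk.form k Θ (QWalk.genAt k Θ μ) (QWalk.genAt k Θ ν)) :=
    QWalk.kInt_congr_ae (htrace.mono fun k hk => by simp only [hk, one_mul])
  rwa [QWalk.asymptoticFisher, hweight] at hqfi
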